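/- **Dyadic strings.** Let $S(\mathrm{dyadic})$ be the set of binary strings $x$ whose length is a power of two, whose left half differs from the right half, and which contain both symbols $0$ and $1$. **Diagrams.** Let $\mathcal G$ be the set of finite directed graphs $G$ with a root vertex $V^r_G$ that is nonterminal and from which every vertex can be reached, with exactly two terminal vertices $T^0_G\neq T^1_G$, with two edges, labelled $0$ and $1$, leading from each nonterminal vertex to two different vertices, and with positive integer levels $L(V)$ such that $L(V^r_G)=1$, $L(T^0_G)=L(T^1_G)$, and $L$ strictly increases along directed paths. Write $V\to V_0,V_1$ if edges $0,1$ lead from $V$ to $V_0,V_1$. Let $\phi_G(T_G^0)=0$, $\phi_G(T_G^1)=1$ and, if $V\to V_0,V_1$, let $\phi_G(V)=\phi_G(V_0)^{2^{L(V_0)-L(V)-1}}\,\phi_G(V_1)^{2^{L(V_1)-L(V)-1}}$ (powers and products are concatenations). $G$ is a ROBDD of $x$ if $\phi_G$ is one-to-one and $\phi_G(V^r_G)=x$. **Codeword.** Let $G$ be a ROBDD of $x$, $|x|=2^k$, so $L(T^0_G)=k+1$. Define sequences of symbols $V^q$ ($V$ a vertex, $q\ge1$; $V=V^1$) by $S_1=(V^r_G)$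 and, for $2\le i\le k+1$: list the distinct entries of $S_{i-1}$ in order of first appearance; replace each $V^q$ with $q>1$ by $V^{q-1}$, and each $V^1$, where $V\to V_0,V_1$, by the two entries $V_0^{L(V_0)-L(V)},V_1^{L(V_1)-L(V)}$; the result is $S_i$, and $\hat S_i$ is its subsequence formed by the entries of the second kind. Let $\pi_i^1$ be the subsequence of the entries $V^q$ of $\hat S_i$ with $V^{q+1}$ in $S_{i-1}$ (type I), and $\pi_i^2$ that of the entries $V^q$ such that no power of $V$ occurs in $S_{i-1}$ (type II). Let $Q_i$ be the sum of the powers $q$ of the distinct entries of $\pi_i^2$. For a finite sequence $u=(u_1,\dots,u_J)$ let $H(u)=-\sum_j\log_2(n(u_j)/J)$, where $n(a)$ is the number of occurrences of $a$ in $u$ ($H=0$ for the empty sequence), and let $\tilde u$ be $u$ with the first appearance of each symbol struck out. The codeword $\sigma(x)$ is the concatenation, for $i=2,\dots,k+1$, of: the frequencies of the distinct entries of $S_i$ in unary, the carried-over symbols $V^{q-1}$ coming first and the new ones next ($|S_i|$ bits); the types of the entries of $\hat S_i$ ($|\hat S_i|$ bits); the powers of the distinct type II entries in unary ($Q_i$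 bits); the index of $\pi_i^1$ among the sequences with the same symbol frequencies ($\lceil H(\pi_i^1)\rceil$ bits); the positions of the first appearances in $\pi_i^2$ ($|\pi_i^2|$ bits); the index of $\tilde\pi_i^2$ among the sequences with the same symbol frequencies ($\lceil H(\tilde\pi_i^2)\rceil$ bits); and, at the end, of one bit telling which of the two terminal vertices is $T^0_G$. **Sources.** A binary $s$-state source consists of a probability distribution $p_0$ on a set $Q$ of $s$ states and, for each state $q$, a probability distribution $p(\cdot,\cdot\mid q)$ on $\{0,1\}\times Q$; it assigns to $x=x_1\cdots x_n$ the probability $\mu(x)=\sum_{q_0,\dots,q_n}p_0(q_0)\prod_{t=1}^n p(x_t,q_t\mid q_{t-1})$. **Theorem.** Each $x\in S(\mathrm{dyadic})$ has a ROBDD $G_x$, unique up to isomorphism. For each $s\ge1$ there is a sequence $\varepsilon_n\to0$ such that, for every binary $s$-state source with probability $\mu$ and every $n=2,4,8,16,\dots$, $$\max\{|\sigma(x)|+\log_2\mu(x) : x\in\{0,1\}^n\cap S(\mathrm{dyadic})\}\le\frac{n}{\log_2 n}\,\bigl(16+4\log_2 s+\varepsilon_n\bigr),$$ where $\log_2 0=-\infty$.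 In other words, the maximal pointwise redundancy per sample, $\max_x \frac1n(|\sigma(x)|+\log_2\mu(x))$, is at most $(4\log_2 s+16+\varepsilon_n)/\log_2 n$. -/

import Mathlib

open Filter Topology

/-! ### Dyadic strings -/

/-- The set `S(dyadic)`: binary strings whose length is a power of two, whose left half differs
from the right half, and in which both symbols occur. -/
def SDyadic : Set (List Bool) :=
  {x | (∃ k : ℕ, x.length = 2 ^ k) ∧
    x.take (x.length / 2) ≠ x.drop (x.length / 2) ∧ true ∈ x ∧ false ∈ x}

/-! ### Levelled decision graphs -/

/-- A finite directed graph with a root, exactly two terminal vertices `T false` and `T true`,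
two edges, labelled `0` and `1`, leading from each nonterminal vertex to two different vertices,
and positive levels, equal to `1` at the root, equal at the two terminals, and strictly
increasing along the edges (hence along all directed paths, so that the graph is acyclic and no
other vertex than `root` reaches all the vertices).
`succ v = some (a, b)` says that edge `0` leads from `v` to `a` and edge `1` from `v` to `b`. -/
structure LevelGraph where
  V : Type
  [fintypeV : Fintype V]
  [decEqV : DecidableEq V]
  succ : V → Option (V × V)
  root : V
  T : Bool → V
  level : V → ℕ
  T_ne : T false ≠ T true
  succ_eq_none_iff : ∀ v, succ v = none ↔ v = T false ∨ v = T true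
  succ_ne : ∀ v a b, succ v = some (a, b) → a ≠ b
  succ_root : succ root ≠ none
  reachable : ∀ v,
    Relation.ReflTransGen (fun u w => ∃ a b, succ u = some (a, b) ∧ (w = a ∨ w = b)) root v
  level_pos : ∀ v, 0 < level v
  level_root : level root = 1
  level_T : level (T false) = level (T true)
  level_lt : ∀ v a b, succ v = some (a, b) → level v < level a ∧ level v < level b

attribute [instance] LevelGraph.fintypeV LevelGraph.decEqV

/-- The concatenation of `m` copies of the string `y`. -/
def strPow {α : Type*} (y : List α) (m : ℕ) : List α := (List.replicate m y).flatten

namespace LevelGraph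

variable (G : LevelGraph)

theorem level_sub_lt {v w : G.V} (h : G.level v < G.level w) :
    Finset.univ.sup G.level - G.level w < Finset.univ.sup G.level - G.level v := by
  have := Finset.le_sup (f := G.level) (Finset.mem_univ w)
  omega

/-- The string `φ_G(v)` attached to the vertex `v`: it is `0` and `1` at the two terminals, and
`φ(v) = φ(a)^(2^(L(a) - L(v) - 1)) φ(b)^(2^(L(b) - L(v) - 1))` if the edges `0`, `1` lead from
`v` to `a`, `b`. -/
def phi (v : G.V) : List Bool :=
  match h : G.succ v with
  | none => [decide (v = G.T true)]
  | some (a, b) =>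
      strPow (phi a) (2 ^ (G.level a - G.level v - 1)) ++
        strPow (phi b) (2 ^ (G.level b - G.level v - 1))
termination_by Finset.univ.sup G.level - G.level v
decreasing_by
  · exact G.level_sub_lt (G.level_lt v a b h).1
  · exact G.level_sub_lt (G.level_lt v a b h).2

/-- `G` is the (reduced, ordered) binary decision diagram of the string `x`: the strings attached
to different vertices are different, and the root carries `x`. -/
def IsROBDDOf (x : List Bool) : Prop :=
  Function.Injective G.phi ∧ G.phi G.root = x

/-- Isomorphism of levelled decision graphs: all of the structure is preserved. -/
def Isomorphic (G G' : LevelGraph) : Prop :=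
  ∃ e : G.V ≃ G'.V, e G.root = G'.root ∧ (∀ b, e (G.T b) = G'.T b) ∧
    (∀ v, G'.level (e v) = G.level v) ∧
    ∀ v, G'.succ (e v) = (G.succ v).map (Prod.map e e)

end LevelGraph

/-! ### Finite sequences -/

section Sequences

variable {α : Type*} [DecidableEq α]

/-- The distinct entries of a sequence, in order of first left-to-right appearance. -/
def firstApp : List α → List α
  | [] => []
  | a :: u => a :: (firstApp u).filter (fun b => decide (b ≠ a))

/-- The positions of first appearances: entry `true` where a term makes its first appearance.
The list `seen` holds the terms already met. -/
def firstFlags (seen : List α) : List α → List Bool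
  | [] => []
  | a :: u => decide (a ∉ seen) :: firstFlags (a :: seen) u

/-- The sequence left over when each term making its first appearance is struck out.
The list `seen` holds the terms already met. -/
def strikeFirst (seen : List α) : List α → List α
  | [] => []
  | a :: u => if a ∈ seen then a :: strikeFirst seen u else strikeFirst (a :: seen) u

/-- The unnormalized empirical entropy `H(u) = ∑ j, -log₂ (n(u_j) / |u|)`. -/
noncomputable def seqEntropy (u : List α) : ℝ :=
  (u.map fun a => -Real.logb 2 ((u.count a : ℝ) / (u.length : ℝ))).sum

/-- The codeword `0 … 0 1` of length `q`, for `q ≥ 1`. -/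
def unary (q : ℕ) : List Bool := List.replicate (q - 1) false ++ List.replicate (min q 1) true

/-- The `w` low order binary digits of `m`. -/
def binDigits (w m : ℕ) : List Bool := (List.range w).map fun i => m.testBit i

/-- The rank of a sequence of numbers, in lexicographic order, among all its rearrangements. -/
def rearrRank (u : List ℕ) : ℕ := (u.permutations.toFinset.filter fun w => w < u).card

/-- The code telling `u` among the sequences with the same symbol frequencies, in `⌈H(u)⌉` bits:
its rank among them, for the order of the symbols given by the list `alph` of symbols. -/
noncomputable def enumCode (alph u : List α) : List Bool :=
  binDigits ⌈seqEntropy u⌉₊ (rearrRank (u.map fun a => alph.idxOf a))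

end Sequences

/-! ### The codeword -/

namespace LevelGraph

variable (G : LevelGraph)

/-- The two entries `a^(L(a)-L(v)), b^(L(b)-L(v))` that replace the entry `v` (of power `1`). -/
def expand (v : G.V) : List (G.V × ℕ) :=
  match G.succ v with
  | none => []
  | some (a, b) => [(a, G.level a - G.level v), (b, G.level b - G.level v)]

/-- One step `S_{i-1} ↦ S_i`: each first appearance of an entry `v^q` with `q > 1` is replaced by
`v^(q-1)`, and each first appearance of an entry `v^1` by the two entries for its successors.
The pair `(v, q)` stands for the symbol `v^q`. -/
def step (S : List (G.V × ℕ)) : List (G.V × ℕ) :=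
  (firstApp S).flatMap fun p => if 1 < p.2 then [(p.1, p.2 - 1)] else G.expand p.1

/-- `G.seq m` is the sequence `S_{m+1}`. -/
def seq : ℕ → List (G.V × ℕ)
  | 0 => [(G.root, 1)]
  | m + 1 => G.step (seq m)

/-- The entries `v^(q-1)` of `G.step S` that come from the distinct entries `v^q`, `q > 1`,
of `S`. -/
def carried (S : List (G.V × ℕ)) : List (G.V × ℕ) :=
  ((firstApp S).filter fun p => decide (1 < p.2)).map fun p => (p.1, p.2 - 1)

/-- The subsequence `Ŝ_i` of `S_i = G.step S` that comes from the distinct entries of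
`S = S_{i-1}` of power `1`. -/
def hat (S : List (G.V × ℕ)) : List (G.V × ℕ) :=
  ((firstApp S).filter fun p => decide (¬ 1 < p.2)).flatMap fun p => G.expand p.1

/-- The entries `v^q` of `Ŝ_i` of type I: `v^(q+1)` appears in `S_{i-1} = S`. -/
def piOne (S : List (G.V × ℕ)) : List (G.V × ℕ) :=
  (G.hat S).filter fun p => decide ((p.1, p.2 + 1) ∈ S)

/-- The entries `v^q` of `Ŝ_i` of type II: no power of `v` appears in `S_{i-1} = S`. -/
def piTwo (S : List (G.V × ℕ)) : List (G.V × ℕ) :=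
  (G.hat S).filter fun p => decide (p.1 ∉ S.map Prod.fst)

/-- The codebits that tell `S_i` to a decoder who knows `S = S_{i-1}`. They are, in order:
the frequencies in `S_i` of its distinct entries, in unary (`|S_i|` bits);
the types of the entries of `Ŝ_i` (`|Ŝ_i|` bits);
the powers of the distinct entries of type II, in unary (`Q_i` bits);
the sequence `π¹` of type I entries, given the frequencies (`⌈H(π¹)⌉` bits);
the positions of the first appearances in the sequence `π²` of type II entries (`|π²|` bits);
what is left of `π²` when these are struck out, given the frequencies. -/
noncomputable def stepCode (S : List (G.V × ℕ)) : List Bool :=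
  (firstApp (G.carried S ++ G.hat S)).flatMap (fun p => unary ((G.step S).count p)) ++
  (G.hat S).map (fun p => decide (p ∉ G.piOne S)) ++
  (firstApp (G.piTwo S)).flatMap (fun p => unary p.2) ++
  enumCode (G.carried S) (G.piOne S) ++
  firstFlags [] (G.piTwo S) ++
  enumCode (firstApp (G.piTwo S)) (strikeFirst [] (G.piTwo S))

/-- The logarithm `k` of the length of the string that `G` represents: the terminals have
level `k + 1`. -/
def depth : ℕ := G.level (G.T false) - 1

/-- The codeword `σ(G)`: the codebits for `S_2, …, S_{k+1}`, followed by one bit that tells which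
of the two terminals appears first in `S_{k+1}`. -/
noncomputable def codeword : List Bool :=
  (List.range G.depth).flatMap (fun m => G.stepCode (G.seq m)) ++
    [decide ((G.seq G.depth).head?.map Prod.fst = some (G.T true))]

end LevelGraph

/-! ### Finite state sources -/

/-- A binary information source with `s` states: an initial distribution on the states, and for
each state `q` a probability distribution on the pairs (emitted symbol, next state). -/
structure FiniteStateSource (s : ℕ) where
  init : Fin s → ℝ
  init_nonneg : ∀ q, 0 ≤ init q
  init_sum : ∑ q, init q = 1
  trans : Fin s → Bool × Fin s → ℝ
  trans_nonneg : ∀ q p, 0 ≤ trans q p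
  trans_sum : ∀ q, ∑ p, trans q p = 1

namespace FiniteStateSource

variable {s : ℕ} (P : FiniteStateSource s)

/-- The probability that the source, started in state `q`, emits the string first. -/
def probFrom : List Bool → Fin s → ℝ
  | [], _ => 1
  | b :: u, q => ∑ r, P.trans q (b, r) * probFrom u r

/-- The probability `μ(x)` that the source assigns to the string `x`. -/
def prob (x : List Bool) : ℝ := ∑ q, P.init q * P.probFrom x q

end FiniteStateSource

/-! ### Powers of strings -/

section Strings

variable {α : Type*}

/-! Write n = 2^k. A symbol v^q of S_{m+1} stands for the string φ(v)^(2^(q-1)). All symbols of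
S_{m+1} stand for strings of the same length 2^(k-m), and distinct symbols stand for distinct
strings because no φ(v) is a square. So the number w_m of distinct symbols is at most min(2^m,
2^(2^(k-m))), and these minima add up to about 2n/log₂ n.

The codebits for one step are then estimated in terms of w = w_m. The lengths of S_i, Ŝ_i and π² are
at most 2w each. Each distinct symbol loses one power per step and the type II symbols bring in Q_i,
so Q_i is w plus the increment of the total power, which telescopes. The entropies are charged to
the source: let the cost of y be -log₂ of the largest probability, over the starting states, of
emitting y. This cost is superadditive under concatenation, so replacing the distinct symbols of
S_{i-1} by S_i does not increase the total cost. Now S_i consists of its distinct symbols, whose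
cost is passed on to the next step, and of π¹ and the struck out π², whose cost pays for the two
entropies. Over strings of one length the largest probabilities add up to at most s, so by Gibbs'
inequality the payment falls short by at most log₂ s per symbol, for at most 2w symbols.

The costs telescope from cost(x) ≤ -log₂ μ(x). The redundancy is thus at most (7 + 2 log₂ s) Σ w_m +
2k + 1, hence asymptotically at most (14 + 4 log₂ s) n/log₂ n; the gap up to 16 swallows the lower
order terms.

The vertices of a diagram correspond to the primitive roots of the dyadic substrings of x, and
halving such a root gives its successors. This yields existence and uniqueness. -/

theorem length_strPow (y : List α) (m : ℕ) : (strPow y m).length = m * y.length := by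
  simp [strPow]

theorem strPow_one (y : List α) : strPow y 1 = y := by
  simp [strPow]

theorem strPow_add (y : List α) (m l : ℕ) : strPow y (m + l) = strPow y m ++ strPow y l := by
  rw [strPow, List.replicate_add, List.flatten_append, strPow, strPow]

theorem strPow_two_pow_succ (y : List α) (i : ℕ) :
    strPow y (2 ^ (i + 1)) = strPow y (2 ^ i) ++ strPow y (2 ^ i) := by
  rw [pow_succ, mul_two, strPow_add]

theorem append_self_inj {y z : List α} (h : y ++ y = z ++ z) : y = z := by
  have hl : y.length = z.length := by
    have := congrArg List.length h
    simp only [List.length_append] at this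
    omega
  exact (List.append_inj h hl).1

/-- The string is not a square; for strings whose length is a power of two this says that the two
halves differ, or that the length is one. -/
def HalvesDiffer (y : List α) : Prop := ∀ z, y ≠ z ++ z

theorem halvesDiffer_singleton (a : α) : HalvesDiffer [a] := by
  intro z h
  have := congrArg List.length h
  simp only [List.length_append, List.length_singleton] at this
  omega

/-- Equal squares have equal halves, so one factor 2 can be removed from both exponents. If one
exponent runs out first, a non-square would be a square. -/
theorem HalvesDiffer.eq_of_strPow_eq {a b : List α} (ha : HalvesDiffer a) (hb : HalvesDiffer b)
    {i j : ℕ} (h : strPow a (2 ^ i) = strPow b (2 ^ j)) : a = b := by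
  induction i generalizing j with
  | zero =>
    cases j with
    | zero => simpa [strPow_one] using h
    | succ j =>
      rw [strPow_two_pow_succ, pow_zero, strPow_one] at h
      exact absurd h (ha _)
  | succ i ih =>
    cases j with
    | zero =>
      rw [strPow_two_pow_succ, pow_zero, strPow_one] at h
      exact absurd h.symm (hb _)
    | succ j =>
      rw [strPow_two_pow_succ, strPow_two_pow_succ] at h
      exact ih (append_self_inj h)

theorem exists_halvesDiffer_strPow {j : ℕ} {y : List α} (hy : y.length = 2 ^ j) :
    ∃ a i, HalvesDiffer a ∧ i ≤ j ∧ a.length = 2 ^ (j - i) ∧ y = strPow a (2 ^ i) := by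
  induction j generalizing y with
  | zero =>
    obtain ⟨a, rfl⟩ := List.length_eq_one_iff.1 (by simpa using hy)
    exact ⟨[a], 0, halvesDiffer_singleton a, le_rfl, by simp, by simp [strPow_one]⟩
  | succ j ih =>
    by_cases hd : HalvesDiffer y
    · exact ⟨y, 0, hd, Nat.zero_le _, by simpa using hy, by simp [strPow_one]⟩
    · simp only [HalvesDiffer, ne_eq, not_forall, not_not] at hd
      obtain ⟨z, rfl⟩ := hd
      have hz : z.length = 2 ^ j := by
        rw [List.length_append, pow_succ] at hy
        omega
      obtain ⟨a, i, ha, hi, hl, rfl⟩ := ih hz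
      exact ⟨a, i + 1, ha, by omega, by rw [hl]; congr 1; omega, by rw [strPow_two_pow_succ]⟩

open Classical in
/-- The string that is not a square and of which `y` is a power with exponent a power of two. -/
noncomputable def primRoot (y : List α) : List α :=
  if h : ∃ a, HalvesDiffer a ∧ ∃ i, y = strPow a (2 ^ i) then h.choose else y

theorem primRoot_strPow {a : List α} (ha : HalvesDiffer a) (i : ℕ) :
    primRoot (strPow a (2 ^ i)) = a := by
  have h : ∃ b, HalvesDiffer b ∧ ∃ l, strPow a (2 ^ i) = strPow b (2 ^ l) := ⟨a, ha, i, rfl⟩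
  rw [primRoot, dif_pos h]
  obtain ⟨hb, l, hl⟩ := h.choose_spec
  exact (ha.eq_of_strPow_eq hb hl).symm

theorem primRoot_spec {j : ℕ} {y : List α} (hy : y.length = 2 ^ j) :
    HalvesDiffer (primRoot y) ∧ ∃ i, i ≤ j ∧ (primRoot y).length = 2 ^ (j - i) ∧
      y = strPow (primRoot y) (2 ^ i) := by
  obtain ⟨a, i, ha, hi, hl, rfl⟩ := exists_halvesDiffer_strPow hy
  rw [primRoot_strPow ha]
  exact ⟨ha, i, hi, hl, rfl⟩

end Strings

theorem SDyadic.halvesDiffer {x : List Bool} (hx : x ∈ SDyadic) : HalvesDiffer x := by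
  rintro z rfl
  refine hx.2.1 ?_
  have : (z ++ z).length / 2 = z.length := by
    rw [List.length_append]
    omega
  rw [this]
  simp

theorem SDyadic.exists_length {x : List Bool} (hx : x ∈ SDyadic) :
    ∃ k, x.length = 2 ^ k ∧ 1 ≤ k := by
  obtain ⟨⟨k, hk⟩, -, ht, hf⟩ := hx
  refine ⟨k, hk, ?_⟩
  by_contra h
  obtain rfl : k = 0 := by omega
  obtain ⟨a, rfl⟩ := List.length_eq_one_iff.1 (by simpa using hk)
  simp only [List.mem_singleton] at ht hf
  simp [← ht] at hf

/-! ### The strings attached to the vertices -/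

namespace LevelGraph

variable (G : LevelGraph)

theorem succ_T (b : Bool) : G.succ (G.T b) = none := by
  rw [G.succ_eq_none_iff]
  cases b <;> simp

theorem T_injective : Function.Injective G.T := by
  intro a b h
  have h₁ := G.T_ne
  have h₂ := G.T_ne.symm
  cases a <;> cases b <;> simp_all

theorem phi_T (b : Bool) : G.phi (G.T b) = [b] := by
  have h := G.succ_T b
  have h' : G.T b = G.T true ↔ b = true := G.T_injective.eq_iff
  rw [phi]
  split
  · cases b <;> simp_all
  · simp_all

theorem phi_of_succ {v a b : G.V} (h : G.succ v = some (a, b)) :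
    G.phi v = strPow (G.phi a) (2 ^ (G.level a - G.level v - 1)) ++
      strPow (G.phi b) (2 ^ (G.level b - G.level v - 1)) := by
  rw [phi]
  split
  · simp_all
  · rename_i a' b' h'
    rw [h] at h'
    cases h'
    rfl

theorem vertex_induction {p : G.V → Prop} (hT : ∀ b, p (G.T b))
    (hs : ∀ v a b, G.succ v = some (a, b) → p a → p b → p v) (v : G.V) : p v := by
  induction h : Finset.univ.sup G.level - G.level v using Nat.strong_induction_on generalizing v with
  | _ m ih =>
    subst h
    match h : G.succ v with
    | none =>
      rcases (G.succ_eq_none_iff v).1 h with rfl | rfl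
      · exact hT _
      · exact hT _
    | some (a, b) =>
      obtain ⟨ha, hb⟩ := G.level_lt v a b h
      exact hs v a b h (ih _ (G.level_sub_lt ha) a rfl) (ih _ (G.level_sub_lt hb) b rfl)

theorem level_T_eq (b : Bool) : G.level (G.T b) = G.depth + 1 := by
  have h := G.level_T
  have h₀ := G.level_pos (G.T false)
  cases b <;> simp only [depth] <;> omega

theorem level_le (v : G.V) : G.level v ≤ G.depth + 1 := by
  induction v using G.vertex_induction with
  | hT b => exact (G.level_T_eq b).le
  | hs v a b h ha hb =>
    have := G.level_lt v a b h
    omega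

theorem exists_succ {v : G.V} (h : G.level v ≠ G.depth + 1) : ∃ a b, G.succ v = some (a, b) := by
  match hs : G.succ v with
  | none =>
    rcases (G.succ_eq_none_iff v).1 hs with rfl | rfl <;> exact absurd (G.level_T_eq _) h
  | some (a, b) => exact ⟨a, b, rfl⟩

theorem length_strPow_of_length {y : List Bool} {d l m : ℕ} (hy : y.length = 2 ^ (d + 1 - l))
    (hl : l ≤ d + 1) (hm : m < l) : (strPow y (2 ^ (l - m - 1))).length = 2 ^ (d - m) := by
  rw [length_strPow, hy, ← pow_add]
  congr 1
  omega

theorem length_phi (v : G.V) : (G.phi v).length = 2 ^ (G.depth + 1 - G.level v) := by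
  induction v using G.vertex_induction with
  | hT b => simp [phi_T, level_T_eq]
  | hs v a b h ha hb =>
    obtain ⟨hva, hvb⟩ := G.level_lt v a b h
    have hla := G.level_le a
    rw [G.phi_of_succ h, List.length_append, length_strPow_of_length ha (G.level_le a) hva,
      length_strPow_of_length hb (G.level_le b) hvb, ← two_mul, ← pow_succ']
    congr 1
    omega

theorem length_strPow_phi {v w : G.V} (h : G.level v < G.level w) :
    (strPow (G.phi w) (2 ^ (G.level w - G.level v - 1))).length = 2 ^ (G.depth - G.level v) :=
  length_strPow_of_length (G.length_phi w) (G.level_le w) h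

variable {G}

/-- The two factors of φ(v) have equal length. If φ(v) were a square they would coincide, so by
induction φ(a) = φ(b), and injectivity would give a = b. -/
theorem halvesDiffer_phi (hG : Function.Injective G.phi) (v : G.V) : HalvesDiffer (G.phi v) := by
  induction v using G.vertex_induction with
  | hT b => rw [phi_T]; exact halvesDiffer_singleton b
  | hs v a b h ha hb =>
    obtain ⟨hva, hvb⟩ := G.level_lt v a b h
    intro z hz
    rw [G.phi_of_succ h] at hz
    have h₁ := G.length_strPow_phi hva
    have h₂ := G.length_strPow_phi hvb
    have hzl : (strPow (G.phi a) (2 ^ (G.level a - G.level v - 1))).length = z.length := by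
      have := congrArg List.length hz
      rw [List.length_append, List.length_append] at this
      omega
    obtain ⟨e₁, e₂⟩ := List.append_inj hz hzl
    exact G.succ_ne v a b h (hG (ha.eq_of_strPow_eq hb (e₁.trans e₂.symm)))

theorem IsROBDDOf.length_eq {x : List Bool} (hG : G.IsROBDDOf x) : x.length = 2 ^ G.depth := by
  rw [← hG.2, length_phi, level_root, Nat.add_sub_cancel]

theorem IsROBDDOf.depth_eq {x : List Bool} (hG : G.IsROBDDOf x) {k : ℕ} (hk : x.length = 2 ^ k) :
    G.depth = k :=
  Nat.pow_right_injective le_rfl (hG.length_eq.symm.trans hk)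

/-! ### Uniqueness of the diagram -/

variable {G' : LevelGraph}

theorem level_eq_of_phi_eq (hd : G.depth = G'.depth) {v : G.V} {v' : G'.V}
    (h : G.phi v = G'.phi v') : G.level v = G'.level v' := by
  have hl := congrArg List.length h
  rw [length_phi, length_phi, hd] at hl
  have := Nat.pow_right_injective le_rfl hl
  have h₁ := G.level_le v
  have h₂ := G'.level_le v'
  omega

/-- The string fixes the level through its length and the successors through the primitive roots of
its halves. Hence two diagrams of x carry the same strings, and matching them is the isomorphism. -/
theorem exists_succ_of_phi_eq (hG : Function.Injective G.phi) (hG' : Function.Injective G'.phi)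
    (hd : G.depth = G'.depth) {v a b : G.V} {v' : G'.V} (h : G.phi v = G'.phi v')
    (hs : G.succ v = some (a, b)) :
    ∃ a' b', G'.succ v' = some (a', b') ∧ G.phi a = G'.phi a' ∧ G.phi b = G'.phi b' := by
  have hl := level_eq_of_phi_eq hd h
  obtain ⟨hva, hvb⟩ := G.level_lt v a b hs
  have hla := G.level_le a
  obtain ⟨a', b', hs'⟩ := G'.exists_succ (v := v') (by omega)
  obtain ⟨hva', hvb'⟩ := G'.level_lt v' a' b' hs'
  refine ⟨a', b', hs', ?_⟩
  rw [G.phi_of_succ hs, G'.phi_of_succ hs'] at h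
  obtain ⟨e₁, e₂⟩ := List.append_inj h
    (by rw [G.length_strPow_phi hva, G'.length_strPow_phi hva', hl, hd])
  exact ⟨(halvesDiffer_phi hG a).eq_of_strPow_eq (halvesDiffer_phi hG' a') e₁,
    (halvesDiffer_phi hG b).eq_of_strPow_eq (halvesDiffer_phi hG' b') e₂⟩

theorem exists_phi_eq (hG : Function.Injective G.phi) (hG' : Function.Injective G'.phi)
    (hd : G.depth = G'.depth) (hr : G.phi G.root = G'.phi G'.root) (v : G.V) :
    ∃ v', G'.phi v' = G.phi v := by
  induction G.reachable v with
  | refl => exact ⟨G'.root, hr.symm⟩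
  | tail _ hstep ih =>
    obtain ⟨v', hv'⟩ := ih
    obtain ⟨a, b, hs, hw⟩ := hstep
    obtain ⟨a', b', -, ha, hb⟩ := exists_succ_of_phi_eq hG hG' hd hv'.symm hs
    rcases hw with rfl | rfl
    · exact ⟨a', ha.symm⟩
    · exact ⟨b', hb.symm⟩

theorem IsROBDDOf.isomorphic {x : List Bool} (hG : G.IsROBDDOf x) (hG' : G'.IsROBDDOf x) :
    G.Isomorphic G' := by
  have hd : G.depth = G'.depth := hG.depth_eq hG'.length_eq
  have hr : G.phi G.root = G'.phi G'.root := hG.2.trans hG'.2.symm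
  choose f hf using exists_phi_eq hG.1 hG'.1 hd hr
  have hinj : Function.Injective f := fun v w h => hG.1 (by rw [← hf v, ← hf w, h])
  have hsurj : Function.Surjective f := by
    intro v'
    obtain ⟨v, hv⟩ := exists_phi_eq hG'.1 hG.1 hd.symm hr.symm v'
    exact ⟨v, hG'.1 (by rw [hf, hv])⟩
  have hbij : Function.Bijective f := ⟨hinj, hsurj⟩
  refine ⟨Equiv.ofBijective f hbij, ?_, ?_, ?_, ?_⟩ <;>
    simp only [Equiv.ofBijective_apply]
  · exact hG'.1 (by rw [hf, hr])
  · exact fun b => hG'.1 (by rw [hf, phi_T, phi_T])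
  · exact fun v => level_eq_of_phi_eq hd.symm (hf v)
  · intro v
    match hs : G.succ v with
    | none =>
      rw [G.succ_eq_none_iff] at hs
      have key : ∀ b, G'.succ (f (G.T b)) = none := by
        intro b
        rw [show f (G.T b) = G'.T b from hG'.1 (by rw [hf, phi_T, phi_T])]
        exact G'.succ_T b
      rcases hs with rfl | rfl
      · simpa using key false
      · simpa using key true
    | some (a, b) =>
      obtain ⟨a', b', hs', ha, hb⟩ := exists_succ_of_phi_eq hG.1 hG'.1 hd (hf v).symm hs
      rw [hs', show a' = f a from hG'.1 (by rw [hf, ha]),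
        show b' = f b from hG'.1 (by rw [hf, hb])]
      rfl

end LevelGraph

/-! ### Existence of the diagram -/

/-- An edge leads from the string `u` to the primitive roots of its two halves. -/
def HalfEdge (u w : List Bool) : Prop :=
  2 ≤ u.length ∧
    (w = primRoot (u.take (u.length / 2)) ∨ w = primRoot (u.drop (u.length / 2)))

theorem length_take_half {y : List Bool} {j : ℕ} (hy : y.length = 2 ^ (j + 1)) :
    (y.take (y.length / 2)).length = 2 ^ j := by
  rw [List.length_take, hy, pow_succ]
  omega

theorem length_drop_half {y : List Bool} {j : ℕ} (hy : y.length = 2 ^ (j + 1)) :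
    (y.drop (y.length / 2)).length = 2 ^ j := by
  rw [List.length_drop, hy, pow_succ]
  omega

theorem exists_eq_two_pow_succ {m j : ℕ} (h : m = 2 ^ j) (hm : 2 ≤ m) :
    ∃ l, j = l + 1 := by
  cases j with
  | zero => simp at h; omega
  | succ l => exact ⟨l, rfl⟩

theorem HalfEdge.spec {u w : List Bool} (h : HalfEdge u w) {j : ℕ} (hu : u.length = 2 ^ j) :
    HalvesDiffer w ∧ ∃ l < j, w.length = 2 ^ l := by
  obtain ⟨h₂, h⟩ := h
  obtain ⟨j, rfl⟩ := exists_eq_two_pow_succ hu h₂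
  have key : ∀ t : List Bool, t.length = 2 ^ j → HalvesDiffer (primRoot t) ∧
      ∃ l < j + 1, (primRoot t).length = 2 ^ l := by
    intro t ht
    obtain ⟨hd, i, -, hl, -⟩ := primRoot_spec ht
    exact ⟨hd, j - i, by omega, hl⟩
  rcases h with rfl | rfl
  · exact key _ (length_take_half hu)
  · exact key _ (length_drop_half hu)

theorem HalfEdge.reach_spec {x y : List Bool} (h : Relation.ReflTransGen HalfEdge x y) {k : ℕ}
    (hk : x.length = 2 ^ k) (hx : HalvesDiffer x) :
    HalvesDiffer y ∧ ∃ j ≤ k, y.length = 2 ^ j := by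
  induction h with
  | refl => exact ⟨hx, k, le_rfl, hk⟩
  | tail _ hstep ih =>
    obtain ⟨-, j, hj, hl⟩ := ih
    obtain ⟨hd, l, hlt, hw⟩ := hstep.spec hl
    exact ⟨hd, l, by omega, hw⟩

theorem mem_of_mem_strPow {α : Type*} {a : α} {y : List α} {m : ℕ} (h : a ∈ strPow y m) :
    a ∈ y := by
  obtain ⟨l, hl, ha⟩ := List.mem_flatten.1 h
  rwa [(List.mem_replicate.1 hl).2] at ha

/-- A symbol of y survives in one of the halves, and in the primitive root of that half. This makes
both terminals vertices of the diagram, as both symbols occur in x. -/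
theorem HalfEdge.reach_singleton {b : Bool} {j : ℕ} {y : List Bool} (hy : y.length = 2 ^ j)
    (hb : b ∈ y) : Relation.ReflTransGen HalfEdge y [b] := by
  induction j using Nat.strong_induction_on generalizing y with
  | _ j ih =>
    cases j with
    | zero =>
      obtain ⟨c, rfl⟩ := List.length_eq_one_iff.1 (by simpa using hy)
      rw [List.mem_singleton] at hb
      rw [hb]
    | succ j =>
      have h₂ : 2 ≤ y.length := by
        rw [hy, pow_succ]
        have := Nat.one_le_two_pow (n := j)
        omega
      have key : ∀ t : List Bool, t.length = 2 ^ j → b ∈ t →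
          Relation.ReflTransGen HalfEdge (primRoot t) [b] := by
        intro t ht hbt
        obtain ⟨-, i, -, hl, he⟩ := primRoot_spec ht
        refine ih (j - i) (by omega) hl ?_
        rw [he] at hbt
        exact mem_of_mem_strPow hbt
      rw [← List.take_append_drop (y.length / 2) y, List.mem_append] at hb
      rcases hb with hb | hb
      · exact (key _ (length_take_half hy) hb).head ⟨h₂, Or.inl rfl⟩
      · exact (key _ (length_drop_half hy) hb).head ⟨h₂, Or.inr rfl⟩

theorem finite_reach_halfEdge {x : List Bool} {k : ℕ} (hk : x.length = 2 ^ k)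
    (hx : HalvesDiffer x) : Finite {y // Relation.ReflTransGen HalfEdge x y} := by
  refine Set.Finite.to_subtype ((List.finite_length_le Bool (2 ^ k)).subset ?_)
  intro y hy
  obtain ⟨-, j, hj, hl⟩ := HalfEdge.reach_spec hy hk hx
  exact hl.le.trans (Nat.pow_le_pow_right two_pos hj)

/-- The diagram of a string: its vertices are the primitive roots of the dyadic substrings. -/
noncomputable def dyadicGraph (x : List Bool) (k : ℕ) (hk : x.length = 2 ^ k) (hx : x ∈ SDyadic) :
    LevelGraph where
  V := {y // Relation.ReflTransGen HalfEdge x y}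
  fintypeV := @Fintype.ofFinite _ (finite_reach_halfEdge hk (SDyadic.halvesDiffer hx))
  decEqV := inferInstance
  succ v := if h : 2 ≤ v.1.length then
      some (⟨primRoot (v.1.take (v.1.length / 2)), v.2.tail ⟨h, Or.inl rfl⟩⟩,
        ⟨primRoot (v.1.drop (v.1.length / 2)), v.2.tail ⟨h, Or.inr rfl⟩⟩)
    else none
  root := ⟨x, .refl⟩
  T b := ⟨[b], HalfEdge.reach_singleton hk (by cases b; exacts [hx.2.2.2, hx.2.2.1])⟩
  level v := k + 1 - Nat.log 2 v.1.length
  T_ne h := by simp at h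
  succ_eq_none_iff v := by
    obtain ⟨-, j, -, hl⟩ := HalfEdge.reach_spec v.2 hk (SDyadic.halvesDiffer hx)
    have hpos : 0 < v.1.length := by rw [hl]; positivity
    simp only [dite_eq_right_iff, reduceCtorEq, imp_false, not_le, Subtype.ext_iff]
    constructor
    · intro h
      obtain ⟨c, hc⟩ := List.length_eq_one_iff.1 (show v.1.length = 1 by omega)
      rw [hc]
      cases c <;> simp
    · rintro (h | h) <;> simp [h]
  succ_ne v a b h := by
    obtain ⟨hd, j, -, hl⟩ := HalfEdge.reach_spec v.2 hk (SDyadic.halvesDiffer hx)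
    split_ifs at h with h₂
    obtain ⟨j, rfl⟩ := exists_eq_two_pow_succ hl h₂
    simp only [Option.some.injEq, Prod.mk.injEq] at h
    obtain ⟨rfl, rfl⟩ := h
    -- Equal roots have equal length, so they enter the two halves with the same exponent. The
    -- halves would then agree and the vertex would be a square.
    intro hab
    rw [Subtype.mk.injEq] at hab
    obtain ⟨-, i, hi, hli, hei⟩ := primRoot_spec (length_take_half hl)
    obtain ⟨-, i', hi', hli', hei'⟩ := primRoot_spec (length_drop_half hl)
    rw [hab, hli'] at hli
    have : i = i' := by
      have := Nat.pow_right_injective le_rfl hli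
      omega
    subst this
    refine hd (v.1.take (v.1.length / 2)) ?_
    conv_lhs => rw [← List.take_append_drop (v.1.length / 2) v.1]
    rw [hei', ← hab, ← hei]
  succ_root := by
    obtain ⟨k', hk', h₁⟩ := SDyadic.exists_length hx
    have : 2 ≤ x.length := by
      rw [hk']
      exact (pow_one 2).symm.le.trans (Nat.pow_le_pow_right two_pos h₁)
    simp [this]
  reachable v := by
    obtain ⟨y, hy⟩ := v
    induction hy with
    | refl => exact .refl
    | tail hreach hstep ih =>
      refine ih.tail ⟨_, _, dif_pos hstep.1, ?_⟩
      simpa only [Subtype.mk.injEq] using hstep.2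
  level_pos v := by
    obtain ⟨-, j, hj, hl⟩ := HalfEdge.reach_spec v.2 hk (SDyadic.halvesDiffer hx)
    rw [hl, Nat.log_pow one_lt_two]
    omega
  level_root := by
    rw [hk, Nat.log_pow one_lt_two]
    omega
  level_T := by simp
  level_lt v a b h := by
    obtain ⟨hd, j, hj, hl⟩ := HalfEdge.reach_spec v.2 hk (SDyadic.halvesDiffer hx)
    split_ifs at h with h₂
    simp only [Option.some.injEq, Prod.mk.injEq] at h
    obtain ⟨rfl, rfl⟩ := h
    have key : ∀ w, HalfEdge v.1 w →
        k + 1 - Nat.log 2 v.1.length < k + 1 - Nat.log 2 w.length := by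
      intro w hw
      obtain ⟨-, l, hlt, hwl⟩ := hw.spec hl
      rw [hl, hwl, Nat.log_pow one_lt_two, Nat.log_pow one_lt_two]
      omega
    exact ⟨key _ ⟨h₂, Or.inl rfl⟩, key _ ⟨h₂, Or.inr rfl⟩⟩

theorem phi_dyadicGraph {x : List Bool} {k : ℕ} (hk : x.length = 2 ^ k) (hx : x ∈ SDyadic)
    (v : (dyadicGraph x k hk hx).V) : (dyadicGraph x k hk hx).phi v = v.1 := by
  induction v using (dyadicGraph x k hk hx).vertex_induction with
  | hT b => rw [LevelGraph.phi_T]; rfl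
  | hs v a b h ha hb =>
    rw [LevelGraph.phi_of_succ _ h, ha, hb]
    obtain ⟨hd, j, hj, hl⟩ := HalfEdge.reach_spec v.2 hk (SDyadic.halvesDiffer hx)
    simp only [dyadicGraph] at h
    split_ifs at h with h₂
    obtain ⟨j, rfl⟩ := exists_eq_two_pow_succ hl h₂
    simp only [Option.some.injEq] at h
    obtain ⟨rfl, rfl⟩ := h
    have key : ∀ t : List Bool, t.length = 2 ^ j →
        strPow (primRoot t) (2 ^ (k + 1 - Nat.log 2 (primRoot t).length -
          (k + 1 - Nat.log 2 v.1.length) - 1)) = t := by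
      intro t ht
      obtain ⟨-, i, hi, hli, hei⟩ := primRoot_spec ht
      rw [hl, hli, Nat.log_pow one_lt_two, Nat.log_pow one_lt_two]
      conv_rhs => rw [hei]
      congr 2
      omega
    conv_rhs => rw [← List.take_append_drop (v.1.length / 2) v.1]
    congr 1
    · exact key _ (length_take_half hl)
    · exact key _ (length_drop_half hl)

theorem exists_isROBDDOf {x : List Bool} (hx : x ∈ SDyadic) :
    ∃ G : LevelGraph, G.IsROBDDOf x := by
  obtain ⟨k, hk, -⟩ := SDyadic.exists_length hx
  refine ⟨dyadicGraph x k hk hx, ?_, phi_dyadicGraph hk hx _⟩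
  intro v w h
  rw [phi_dyadicGraph, phi_dyadicGraph] at h
  exact Subtype.ext h

/-! ### Finite sequences -/

section SequenceLemmas

variable {α : Type*} [DecidableEq α]

theorem mem_firstApp {a : α} {u : List α} : a ∈ firstApp u ↔ a ∈ u := by
  induction u with
  | nil => simp [firstApp]
  | cons b u ih =>
    simp only [firstApp, List.mem_cons, List.mem_filter, ih, decide_eq_true_eq]
    tauto

theorem nodup_firstApp (u : List α) : (firstApp u).Nodup := by
  induction u with
  | nil => simp [firstApp]
  | cons b u ih =>
    rw [firstApp, List.nodup_cons]
    exact ⟨by simp, ih.filter _⟩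

theorem length_firstApp_le (u : List α) : (firstApp u).length ≤ u.length :=
  ((nodup_firstApp u).subperm fun _ h => mem_firstApp.1 h).length_le

theorem firstApp_perm_dedup (u : List α) : (firstApp u).Perm u.dedup :=
  (List.perm_ext_iff_of_nodup (nodup_firstApp u) u.nodup_dedup).2
    fun a => by rw [mem_firstApp, List.mem_dedup]

theorem length_firstFlags (seen u : List α) : (firstFlags seen u).length = u.length := by
  induction u generalizing seen with
  | nil => rfl
  | cons a u ih => simp [firstFlags, ih]

/-- The list `seen` is kept general for the induction; only the empty list is used later. -/
theorem filter_firstApp_append_strikeFirst_perm (seen u : List α) :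
    ((firstApp u).filter (fun a => decide (a ∉ seen)) ++ strikeFirst seen u).Perm u := by
  induction u generalizing seen with
  | nil => simp [firstApp, strikeFirst]
  | cons a u ih =>
    rw [firstApp, strikeFirst]
    split_ifs with h
    · rw [List.filter_cons_of_neg (by simpa using h), List.filter_filter]
      refine List.perm_middle.trans (List.Perm.cons a (List.Perm.trans ?_ (ih seen)))
      refine List.Perm.of_eq ?_
      congr 1
      refine List.filter_congr fun b _ => ?_
      by_cases hb : b ∈ seen
      · simp [hb]
      · have : b ≠ a := fun e => hb (e ▸ h)
        simp [hb, this]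
    · rw [List.filter_cons_of_pos (by simpa using h), List.filter_filter, List.cons_append]
      refine List.Perm.cons a (List.Perm.trans (List.Perm.of_eq ?_) (ih (a :: seen)))
      congr 1
      refine List.filter_congr fun b _ => ?_
      by_cases hb : b ∈ seen <;> by_cases hba : b = a <;> simp [hb, hba]

theorem firstApp_append_strikeFirst_perm (u : List α) :
    (firstApp u ++ strikeFirst [] u).Perm u := by
  simpa using filter_firstApp_append_strikeFirst_perm [] u

theorem length_unary (q : ℕ) : (unary q).length = q := by
  simp only [unary, List.length_append, List.length_replicate]
  omega

theorem length_flatMap_unary {β : Type*} (u : List β) (f : β → ℕ) :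
    (u.flatMap fun p => unary (f p)).length = (u.map f).sum := by
  simp [List.length_flatMap, length_unary]

theorem sum_map_count_firstApp (u : List α) :
    ((firstApp u).map fun a => u.count a).sum = u.length := by
  rw [((firstApp_perm_dedup u).map _).sum_eq]
  exact List.sum_map_count_dedup_eq_length u

theorem length_enumCode (alph u : List α) : (enumCode alph u).length = ⌈seqEntropy u⌉₊ := by
  simp [enumCode, binDigits]

theorem seqEntropy_nonneg (u : List α) : 0 ≤ seqEntropy u := by
  refine List.sum_nonneg fun r hr => ?_
  obtain ⟨a, -, rfl⟩ := List.mem_map.1 hr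
  have h : ((u.count a : ℝ) / u.length) ≤ 1 :=
    div_le_one_of_le₀ (by exact_mod_cast List.count_le_length) (Nat.cast_nonneg _)
  have := Real.logb_nonpos one_lt_two (by positivity) h
  linarith

/-- Gibbs' inequality: the empirical entropy is at most the ideal code length for any
subprobability on the symbols. -/
theorem seqEntropy_le_sum_neg_logb (u : List α) (w : α → ℝ) (hw : ∀ a ∈ u, 0 < w a)
    (hsum : ∑ a ∈ u.toFinset, w a ≤ 1) :
    seqEntropy u ≤ (u.map fun a => -Real.logb 2 (w a)).sum := by
  have hln : 0 < Real.log 2 := Real.log_pos one_lt_two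
  rw [seqEntropy, Finset.sum_list_map_count, Finset.sum_list_map_count]
  have hlen : ∑ a ∈ u.toFinset, (u.count a : ℝ) = u.length := by
    exact_mod_cast List.sum_toFinset_count_eq_length u
  have hterm : ∀ a ∈ u.toFinset,
      u.count a • -Real.logb 2 ((u.count a : ℝ) / (u.length : ℝ)) ≤
        u.count a • -Real.logb 2 (w a) + (w a * u.length - u.count a) / Real.log 2 := by
    intro a ha
    rw [List.mem_toFinset] at ha
    have hc : (0 : ℝ) < u.count a := by exact_mod_cast List.count_pos_iff.2 ha
    have hJ : (0 : ℝ) < u.length := by exact_mod_cast List.length_pos_of_mem ha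
    have hwa := hw a ha
    -- This is log t ≤ t - 1 at the ratio t of the proposed weight to the empirical frequency of a.
    have h := Real.log_le_sub_one_of_pos (show 0 < w a * u.length / u.count a by positivity)
    rw [Real.log_div (by positivity) hc.ne', Real.log_mul hwa.ne' hJ.ne'] at h
    have h' : (u.count a : ℝ) * (Real.log (w a) + Real.log u.length - Real.log (u.count a)) ≤
        w a * u.length - u.count a := by
      refine (mul_le_mul_of_nonneg_left h hc.le).trans (le_of_eq ?_)
      field_simp
    rw [nsmul_eq_mul, nsmul_eq_mul, Real.logb, Real.logb, Real.log_div hc.ne' hJ.ne',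
      ← sub_nonneg]
    have : (u.count a : ℝ) * -(Real.log (w a) / Real.log 2) +
        (w a * u.length - u.count a) / Real.log 2 -
        u.count a * -((Real.log (u.count a) - Real.log u.length) / Real.log 2) =
        ((w a * u.length - u.count a) -
          u.count a * (Real.log (w a) + Real.log u.length - Real.log (u.count a))) /
          Real.log 2 := by ring
    rw [this]
    exact div_nonneg (sub_nonneg.2 h') hln.le
  refine (Finset.sum_le_sum hterm).trans ?_
  rw [Finset.sum_add_distrib, ← Finset.sum_div, Finset.sum_sub_distrib, hlen, ← Finset.sum_mul]
  have : (∑ a ∈ u.toFinset, w a) * u.length - u.length ≤ 0 := by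
    have := mul_le_mul_of_nonneg_right hsum (Nat.cast_nonneg (α := ℝ) u.length)
    linarith
  have := div_nonpos_of_nonpos_of_nonneg this hln.le
  linarith

end SequenceLemmas

theorem flatMap_ite_perm {α β : Type*} (c : α → Bool) (f : α → β) (g : α → List β) (l : List α) :
    (l.flatMap fun p => if c p then [f p] else g p).Perm
      ((l.filter c).map f ++ (l.filter fun p => !c p).flatMap g) := by
  induction l with
  | nil => simp
  | cons a l ih =>
    rw [List.flatMap_cons]
    cases h : c a
    · simp only [h, Bool.false_eq_true, not_false_eq_true, List.filter_cons_of_neg, if_false,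
        Bool.not_false, List.filter_cons_of_pos, List.flatMap_cons]
      refine (ih.append_left (g a)).trans ?_
      rw [← List.append_assoc, ← List.append_assoc]
      exact List.perm_append_comm.append_right _
    · simpa [h] using ih

theorem card_le_two_pow {A : Finset (List Bool)} {l : ℕ} (h : ∀ y ∈ A, y.length = l) :
    A.card ≤ 2 ^ l := by
  let f : A → List.Vector Bool l := fun y => ⟨y.1, h y.1 y.2⟩
  have hf : Function.Injective f := fun y z hyz => by
    have : (f y).1 = (f z).1 := by rw [hyz]
    exact Subtype.ext this
  have := Fintype.card_le_of_injective f hf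
  rwa [Fintype.card_coe, card_vector, Fintype.card_bool] at this

/-! ### Finite state sources -/

namespace FiniteStateSource

variable {s : ℕ} (P : FiniteStateSource s)

theorem probFrom_nonneg (y : List Bool) (q : Fin s) : 0 ≤ P.probFrom y q := by
  induction y generalizing q with
  | nil => exact zero_le_one
  | cons b u ih => exact Finset.sum_nonneg fun r _ => mul_nonneg (P.trans_nonneg _ _) (ih r)

/-- In whatever state the source is left after u, it emits v with probability at most M. -/
theorem probFrom_append_le {u v : List Bool} {M : ℝ} (hM : ∀ r, P.probFrom v r ≤ M) (q : Fin s) :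
    P.probFrom (u ++ v) q ≤ P.probFrom u q * M := by
  induction u generalizing q with
  | nil => simpa [probFrom] using hM q
  | cons b u ih =>
    rw [List.cons_append, probFrom, probFrom, Finset.sum_mul]
    refine Finset.sum_le_sum fun r _ => ?_
    rw [mul_assoc]
    exact mul_le_mul_of_nonneg_left (ih r) (P.trans_nonneg _ _)

theorem sum_probFrom_le_one {l : ℕ} {A : Finset (List Bool)} (hA : ∀ y ∈ A, y.length = l)
    (q : Fin s) : ∑ y ∈ A, P.probFrom y q ≤ 1 := by
  induction l generalizing A q with
  | zero =>
    have hsub : A ⊆ {[]} := fun y hy => by simpa using hA y hy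
    refine (Finset.sum_le_sum_of_subset_of_nonneg hsub fun y _ _ => P.probFrom_nonneg y q).trans ?_
    simp [probFrom]
  | succ l ih =>
    -- Enlarging A to a product of first symbols and tails only adds nonnegative terms, and the sum
    -- then factors along the first transition.
    have hsub : A ⊆ ((Finset.univ : Finset Bool) ×ˢ A.image List.tail).image
        fun p => p.1 :: p.2 := by
      intro y hy
      have hl := hA y hy
      cases y with
      | nil => simp at hl
      | cons b u =>
        refine Finset.mem_image.2 ⟨(b, u), ?_, rfl⟩
        exact Finset.mem_product.2 ⟨Finset.mem_univ _, Finset.mem_image.2 ⟨b :: u, hy, rfl⟩⟩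
    have htail : ∀ u ∈ A.image List.tail, u.length = l := by
      intro u hu
      obtain ⟨y, hy, rfl⟩ := Finset.mem_image.1 hu
      rw [List.length_tail, hA y hy, Nat.add_sub_cancel]
    refine (Finset.sum_le_sum_of_subset_of_nonneg hsub fun y _ _ => P.probFrom_nonneg y q).trans ?_
    rw [Finset.sum_image (fun a _ b _ h => by
      obtain ⟨h₁, h₂⟩ := List.cons.inj h
      exact Prod.ext h₁ h₂), Finset.sum_product, ← P.trans_sum q, Fintype.sum_prod_type]
    refine Finset.sum_le_sum fun b _ => ?_
    simp only [probFrom]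
    rw [Finset.sum_comm]
    refine Finset.sum_le_sum fun r _ => ?_
    rw [← Finset.mul_sum]
    exact mul_le_of_le_one_right (P.trans_nonneg _ _) (ih htail r)

/-- The largest probability with which the source, started in any of its states, emits the
string. -/
noncomputable def maxProb (y : List Bool) : ℝ := ⨆ q, P.probFrom y q

theorem probFrom_le_maxProb (y : List Bool) (q : Fin s) : P.probFrom y q ≤ P.maxProb y :=
  le_ciSup (Set.finite_range (P.probFrom y)).bddAbove q

theorem maxProb_nonneg (y : List Bool) : 0 ≤ P.maxProb y :=
  Real.iSup_nonneg (P.probFrom_nonneg y)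

theorem maxProb_le_one (y : List Bool) : P.maxProb y ≤ 1 := by
  refine Real.iSup_le (fun q => ?_) zero_le_one
  simpa using P.sum_probFrom_le_one (A := {y}) (l := y.length) (by simp) q

theorem maxProb_append_le (u v : List Bool) : P.maxProb (u ++ v) ≤ P.maxProb u * P.maxProb v := by
  refine Real.iSup_le (fun q => ?_) (mul_nonneg (P.maxProb_nonneg u) (P.maxProb_nonneg v))
  exact (P.probFrom_append_le (P.probFrom_le_maxProb v) q).trans
    (mul_le_mul_of_nonneg_right (P.probFrom_le_maxProb u q) (P.maxProb_nonneg v))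

/-- A maximum over states is at most the sum over states, and each state contributes at most 1. This
is where the term log₂ s of the redundancy originates. -/
theorem sum_maxProb_le {l : ℕ} {A : Finset (List Bool)} (hA : ∀ y ∈ A, y.length = l) :
    ∑ y ∈ A, P.maxProb y ≤ s := by
  calc ∑ y ∈ A, P.maxProb y ≤ ∑ y ∈ A, ∑ q, P.probFrom y q := by
        refine Finset.sum_le_sum fun y _ => Real.iSup_le (fun q => ?_)
          (Finset.sum_nonneg fun q _ => P.probFrom_nonneg y q)
        exact Finset.single_le_sum (fun r _ => P.probFrom_nonneg y r) (Finset.mem_univ q)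
    _ = ∑ q, ∑ y ∈ A, P.probFrom y q := Finset.sum_comm
    _ ≤ ∑ _q : Fin s, (1 : ℝ) := Finset.sum_le_sum fun q _ => P.sum_probFrom_le_one hA q
    _ = s := by simp

theorem prob_nonneg (x : List Bool) : 0 ≤ P.prob x :=
  Finset.sum_nonneg fun q _ => mul_nonneg (P.init_nonneg q) (P.probFrom_nonneg x q)

theorem prob_le_maxProb (x : List Bool) : P.prob x ≤ P.maxProb x := by
  calc P.prob x ≤ ∑ q, P.init q * P.maxProb x :=
        Finset.sum_le_sum fun q _ =>
          mul_le_mul_of_nonneg_left (P.probFrom_le_maxProb x q) (P.init_nonneg q)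
    _ = P.maxProb x := by rw [← Finset.sum_mul, P.init_sum, one_mul]

theorem states_pos {s : ℕ} (P : FiniteStateSource s) : 0 < s := by
  rcases Nat.eq_zero_or_pos s with rfl | h
  · simpa using P.init_sum
  · exact h

/-- The ideal code length of a string for the largest probability `maxProb`. -/
noncomputable def cost (y : List Bool) : ℝ := -Real.logb 2 (P.maxProb y)

theorem cost_nonneg (y : List Bool) : 0 ≤ P.cost y :=
  neg_nonneg.2 (Real.logb_nonpos one_lt_two (P.maxProb_nonneg y) (P.maxProb_le_one y))

theorem maxProb_pos_of_append {u v : List Bool} (h : 0 < P.maxProb (u ++ v)) :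
    0 < P.maxProb u ∧ 0 < P.maxProb v := by
  have := h.trans_le (P.maxProb_append_le u v)
  refine ⟨(P.maxProb_nonneg u).lt_of_ne' ?_, (P.maxProb_nonneg v).lt_of_ne' ?_⟩ <;>
    intro h₀ <;> simp [h₀] at this

/-- Positivity matters: `Real.logb 2 0` is 0, so an impossible string would have cost 0 rather than
infinite cost. -/
theorem cost_add_cost_le {u v : List Bool} (h : 0 < P.maxProb (u ++ v)) :
    P.cost u + P.cost v ≤ P.cost (u ++ v) := by
  obtain ⟨hu, hv⟩ := P.maxProb_pos_of_append h
  have := Real.logb_le_logb_of_le one_lt_two h (P.maxProb_append_le u v)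
  rw [Real.logb_mul hu.ne' hv.ne'] at this
  simp only [cost]
  linarith

end FiniteStateSource

/-! ### The sequences of the codeword -/

namespace LevelGraph

variable (G : LevelGraph)

theorem step_perm (S : List (G.V × ℕ)) : (G.step S).Perm (G.carried S ++ G.hat S) := by
  have := flatMap_ite_perm (fun p : G.V × ℕ => decide (1 < p.2)) (fun p => (p.1, p.2 - 1))
    (fun p => G.expand p.1) (firstApp S)
  simpa only [step, carried, hat, decide_eq_true_eq, decide_not] using this

/-- The symbols `v^q` of the sequence `S` have `q ≥ 1` and `L(v) = m + q`. -/
def Balanced (m : ℕ) (S : List (G.V × ℕ)) : Prop :=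
  ∀ p ∈ S, 1 ≤ p.2 ∧ G.level p.1 = m + p.2

variable {G}

theorem mem_carried {S : List (G.V × ℕ)} {p : G.V × ℕ} :
    p ∈ G.carried S ↔ 1 ≤ p.2 ∧ (p.1, p.2 + 1) ∈ S := by
  simp only [carried, List.mem_map, List.mem_filter, mem_firstApp, decide_eq_true_eq]
  constructor
  · rintro ⟨r, ⟨hr, h₁⟩, rfl⟩
    refine ⟨by simp only; omega, ?_⟩
    convert hr using 2
    simp only
    omega
  · rintro ⟨h₁, h⟩
    exact ⟨_, ⟨h, by simp only; omega⟩, by simp⟩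

theorem mem_hat {S : List (G.V × ℕ)} {p : G.V × ℕ} :
    p ∈ G.hat S ↔ ∃ r ∈ S, ¬ 1 < r.2 ∧ p ∈ G.expand r.1 := by
  simp only [hat, List.mem_flatMap, List.mem_filter, mem_firstApp, decide_eq_true_eq, and_assoc]

theorem mem_step {S : List (G.V × ℕ)} {p : G.V × ℕ} :
    p ∈ G.step S ↔ p ∈ G.carried S ∨ p ∈ G.hat S := by
  rw [(G.step_perm S).mem_iff, List.mem_append]

theorem expand_of_succ {v a b : G.V} (h : G.succ v = some (a, b)) :
    G.expand v = [(a, G.level a - G.level v), (b, G.level b - G.level v)] := by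
  simp only [expand, h]

theorem mem_expand {v : G.V} {p : G.V × ℕ} (h : p ∈ G.expand v) :
    G.level v < G.level p.1 ∧ p.2 = G.level p.1 - G.level v := by
  match hs : G.succ v with
  | none => simp [expand, hs] at h
  | some (a, b) =>
    obtain ⟨ha, hb⟩ := G.level_lt v a b hs
    rw [expand_of_succ hs] at h
    simp only [List.mem_cons, List.not_mem_nil, or_false] at h
    rcases h with rfl | rfl
    · exact ⟨ha, rfl⟩
    · exact ⟨hb, rfl⟩

theorem length_expand_le (v : G.V) : (G.expand v).length ≤ 2 := by
  match hs : G.succ v with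
  | none => simp [expand, hs]
  | some (a, b) => simp [expand_of_succ hs]

theorem length_flatMap_le {α β : Type*} (l : List α) (f : α → List β) {c : ℕ}
    (h : ∀ a, (f a).length ≤ c) : (l.flatMap f).length ≤ c * l.length := by
  induction l with
  | nil => simp
  | cons a l ih =>
    rw [List.flatMap_cons, List.length_append, List.length_cons, mul_add]
    have := h a
    omega

theorem length_step_le (S : List (G.V × ℕ)) : (G.step S).length ≤ 2 * (firstApp S).length := by
  refine length_flatMap_le _ _ fun p => ?_
  split_ifs
  · simp
  · exact length_expand_le _

theorem length_hat_le (S : List (G.V × ℕ)) : (G.hat S).length ≤ 2 * (firstApp S).length :=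
  (length_flatMap_le _ _ fun _ => length_expand_le _).trans
    (Nat.mul_le_mul_left _ (List.length_filter_le _ _))

theorem nodup_carried (S : List (G.V × ℕ)) : (G.carried S).Nodup := by
  refine List.Nodup.map_on ?_ ((nodup_firstApp S).filter _)
  rintro ⟨v, q⟩ hp ⟨w, r⟩ hr heq
  simp only [List.mem_filter, decide_eq_true_eq, Prod.mk.injEq] at hp hr heq ⊢
  exact ⟨heq.1, by omega⟩

theorem length_piTwo_le (S : List (G.V × ℕ)) : (G.piTwo S).length ≤ 2 * (firstApp S).length :=
  (List.length_filter_le _ _).trans (length_hat_le S)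

theorem length_stepCode (S : List (G.V × ℕ)) :
    (G.stepCode S).length = (G.step S).length + (G.hat S).length +
      ((firstApp (G.piTwo S)).map Prod.snd).sum + ⌈seqEntropy (G.piOne S)⌉₊ +
      (G.piTwo S).length + ⌈seqEntropy (strikeFirst [] (G.piTwo S))⌉₊ := by
  have hcount : ((firstApp (G.carried S ++ G.hat S)).map fun p => (G.step S).count p).sum =
      (G.step S).length := by
    rw [(G.step_perm S).length_eq, ← sum_map_count_firstApp (G.carried S ++ G.hat S)]
    congr 1
    refine List.map_congr_left fun p _ => ((G.step_perm S).count_eq p).trans ?_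
    congr 1
    -- The two counts differ only in the instance of `BEq` on the symbols.
    exact lawful_beq_subsingleton _ _
  simp only [stepCode, List.length_append, length_flatMap_unary, hcount, List.length_map,
    length_enumCode, length_firstFlags]

/-! ### Bookkeeping for one step of the sequence -/

namespace Balanced

variable {m : ℕ} {S : List (G.V × ℕ)}

theorem step (h : G.Balanced m S) : G.Balanced (m + 1) (G.step S) := by
  intro p hp
  rcases mem_step.1 hp with hp | hp
  · obtain ⟨h₁, hp⟩ := mem_carried.1 hp
    have := (h _ hp).2
    simp only at this
    exact ⟨h₁, by omega⟩
  · obtain ⟨r, hr, hr₁, hp⟩ := mem_hat.1 hp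
    obtain ⟨hl, hp⟩ := mem_expand hp
    have := h r hr
    omega

theorem hat (h : G.Balanced m S) : G.Balanced (m + 1) (G.hat S) :=
  fun p hp => h.step p (mem_step.2 (Or.inr hp))

/-- The two types exhaust Ŝ_i because the level fixes the power: if some v^r occurs in S_{i-1} and
v^q in Ŝ_i, then m + r = L(v) = m + 1 + q, so r = q + 1. -/
theorem piOne_append_piTwo_perm (h : G.Balanced m S) :
    (G.piOne S ++ G.piTwo S).Perm (G.hat S) := by
  refine List.Perm.trans (List.Perm.of_eq ?_)
    (List.filter_append_perm (fun p => decide ((p.1, p.2 + 1) ∈ S)) (G.hat S))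
  rw [piOne, piTwo]
  congr 1
  refine List.filter_congr fun p hp => ?_
  rw [← decide_not, decide_eq_decide, not_iff_not]
  constructor
  · intro hmem
    obtain ⟨⟨v, q⟩, hr, hv⟩ := List.mem_map.1 hmem
    simp only at hv
    subst hv
    have h₁ := (h _ hr).2
    have h₂ := (h.hat p hp).2
    simp only at h₁
    rwa [show p.2 + 1 = q by omega]
  · exact fun hmem => List.mem_map.2 ⟨_, hmem, rfl⟩

/-- Type I entries are already among the carried-over symbols, so only type II entries bring new
ones. -/
theorem firstApp_step_perm (h : G.Balanced m S) :
    (firstApp (G.step S)).Perm (G.carried S ++ firstApp (G.piTwo S)) := by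
  refine (List.perm_ext_iff_of_nodup (nodup_firstApp _) ?_).2 ?_
  · rw [List.nodup_append']
    refine ⟨nodup_carried S, nodup_firstApp _, fun p h₁ h₂ => ?_⟩
    rw [mem_firstApp, piTwo, List.mem_filter, decide_eq_true_eq] at h₂
    exact h₂.2 (List.mem_map.2 ⟨_, (mem_carried.1 h₁).2, rfl⟩)
  · intro p
    rw [mem_firstApp, mem_step, List.mem_append, mem_firstApp, ← h.piOne_append_piTwo_perm.mem_iff,
      List.mem_append]
    constructor
    · rintro (hp | hp | hp)
      · exact Or.inl hp
      · rw [piOne, List.mem_filter, decide_eq_true_eq] at hp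
        exact Or.inl (mem_carried.2 ⟨(h.hat p hp.1).1, hp.2⟩)
      · exact Or.inr hp
    · rintro (hp | hp)
      · exact Or.inl hp
      · exact Or.inr (Or.inr hp)

/-- Up to order, the sequence `S_i` consists of its distinct entries, the type I entries, and what
is left of the type II entries. -/
theorem step_perm (h : G.Balanced m S) :
    (G.step S).Perm
      (firstApp (G.step S) ++ (G.piOne S ++ strikeFirst [] (G.piTwo S))) := by
  have h₁ := (G.step_perm S).trans (h.piOne_append_piTwo_perm.symm.append_left _)
  have h₂ := (firstApp_append_strikeFirst_perm (G.piTwo S)).symm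
  refine h₁.trans (((h₂.append_left _).append_left _).trans ?_)
  refine List.Perm.trans ?_ (h.firstApp_step_perm.symm.append_right _)
  rw [List.append_assoc]
  refine List.Perm.append_left _ ?_
  rw [← List.append_assoc, ← List.append_assoc]
  exact List.perm_append_comm.append_right _

/-- Each distinct symbol loses one unit of power, those of power 1 disappearing from the count, and
the new type II symbols bring in their own powers. -/
theorem sum_powers_add (h : G.Balanced m S) :
    ((firstApp S).map Prod.snd).sum + ((firstApp (G.piTwo S)).map Prod.snd).sum =
      ((firstApp (G.step S)).map Prod.snd).sum + (firstApp S).length := by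
  rw [(h.firstApp_step_perm.map Prod.snd).sum_eq, List.map_append, List.sum_append]
  have key : ∀ l : List (G.V × ℕ), (∀ p ∈ l, 1 ≤ p.2) → (l.map Prod.snd).sum =
      (((l.filter fun p => decide (1 < p.2)).map fun p => (p.1, p.2 - 1)).map Prod.snd).sum +
        l.length := by
    intro l hl
    induction l with
    | nil => rfl
    | cons p l ih =>
      have ih := ih fun r hr => hl r (List.mem_cons_of_mem _ hr)
      have hp := hl p List.mem_cons_self
      by_cases h₁ : 1 < p.2
      · rw [List.filter_cons_of_pos (by simpa using h₁)]
        simp only [List.map_cons, List.sum_cons, List.length_cons]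
        omega
      · rw [List.filter_cons_of_neg (by simpa using h₁)]
        simp only [List.map_cons, List.sum_cons, List.length_cons]
        omega
  rw [key (firstApp S) fun p hp => (h p (mem_firstApp.1 hp)).1, carried]
  omega

/-- If no replacement increases the potential f, the whole of S_i has no more potential than the
distinct symbols of S_{i-1}. By `step_perm` the potential of S_i splits into a part passed on to the
next step and a part available for the entropies. -/
theorem sum_potential_le (h : G.Balanced m S) (f : G.V × ℕ → ℝ)
    (h₁ : ∀ p ∈ S, 1 < p.2 → f (p.1, p.2 - 1) ≤ f p)
    (h₂ : ∀ p ∈ S, ¬ 1 < p.2 → ((G.expand p.1).map f).sum ≤ f p) :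
    ((firstApp (G.step S)).map f).sum +
      (((G.piOne S).map f).sum + ((strikeFirst [] (G.piTwo S)).map f).sum) ≤
      ((firstApp S).map f).sum := by
  have hperm := (h.step_perm.map f).sum_eq
  simp only [List.map_append, List.sum_append] at hperm
  rw [← hperm, LevelGraph.step]
  have key : ∀ l : List (G.V × ℕ), (∀ p ∈ l, p ∈ S) →
      ((l.flatMap fun p => if 1 < p.2 then [(p.1, p.2 - 1)] else G.expand p.1).map f).sum ≤
        (l.map f).sum := by
    intro l hl
    induction l with
    | nil => simp
    | cons p l ih =>
      have ih := ih fun r hr => hl r (List.mem_cons_of_mem _ hr)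
      have hp := hl p List.mem_cons_self
      rw [List.flatMap_cons, List.map_append, List.sum_append, List.map_cons, List.sum_cons]
      refine add_le_add ?_ ih
      split_ifs with hq
      · simpa using h₁ p hp hq
      · exact h₂ p hp hq
  exact key _ fun p hp => mem_firstApp.1 hp

theorem length_piOne_add_le (h : G.Balanced m S) :
    (G.piOne S).length + (strikeFirst [] (G.piTwo S)).length ≤ 2 * (firstApp S).length := by
  have h₁ := h.piOne_append_piTwo_perm.length_eq
  have h₂ := (firstApp_append_strikeFirst_perm (G.piTwo S)).length_eq
  have h₃ := length_hat_le S
  rw [List.length_append] at h₁ h₂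
  omega

end Balanced

variable (G) in
theorem balanced_seq (m : ℕ) : G.Balanced m (G.seq m) := by
  induction m with
  | zero =>
    intro p hp
    rw [seq, List.mem_singleton] at hp
    subst hp
    simp [G.level_root]
  | succ m ih => exact ih.step

/-- The string represented by the symbol `v^q`. -/
def symbolString (p : G.V × ℕ) : List Bool := strPow (G.phi p.1) (2 ^ (p.2 - 1))

theorem Balanced.length_symbolString {m : ℕ} {S : List (G.V × ℕ)} (h : G.Balanced m S)
    {p : G.V × ℕ} (hp : p ∈ S) : (symbolString p).length = 2 ^ (G.depth - m) := by
  obtain ⟨h₁, h₂⟩ := h p hp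
  have := G.level_le p.1
  rw [symbolString, length_strPow, length_phi, ← pow_add]
  congr 1
  omega

/-- As φ(v) is not a square, its power determines v; the level of v then determines q. -/
theorem Balanced.symbolString_injOn {m : ℕ} {S : List (G.V × ℕ)} (h : G.Balanced m S)
    (hG : Function.Injective G.phi) {p r : G.V × ℕ} (hp : p ∈ S) (hr : r ∈ S)
    (heq : symbolString p = symbolString r) : p = r := by
  have hv : p.1 = r.1 :=
    hG ((halvesDiffer_phi hG p.1).eq_of_strPow_eq (halvesDiffer_phi hG r.1) heq)
  have h₁ := (h p hp).2
  have h₂ := (h r hr).2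
  rw [hv] at h₁
  exact Prod.ext hv (by omega)

theorem symbolString_of_one_lt {p : G.V × ℕ} (h : 1 < p.2) :
    symbolString p = symbolString (p.1, p.2 - 1) ++ symbolString (p.1, p.2 - 1) := by
  obtain ⟨v, q⟩ := p
  obtain ⟨q, rfl⟩ : ∃ l, q = l + 2 := ⟨q - 2, by simp only at h; omega⟩
  simp [symbolString, strPow_two_pow_succ]

theorem symbolString_of_succ {v a b : G.V} (h : G.succ v = some (a, b)) :
    symbolString (v, 1) = symbolString (a, G.level a - G.level v) ++
      symbolString (b, G.level b - G.level v) := by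
  simp only [symbolString, Nat.sub_self, pow_zero, strPow_one]
  exact G.phi_of_succ h

/-! ### The number of distinct entries -/

variable (G) in
/-- The number of distinct entries of `G.seq m`. -/
def width (m : ℕ) : ℕ := (firstApp (G.seq m)).length

theorem width_le_two_pow (m : ℕ) : G.width m ≤ 2 ^ m := by
  induction m with
  | zero => exact (length_firstApp_le _).trans (by simp [seq])
  | succ m ih =>
    have : G.width (m + 1) ≤ 2 * G.width m :=
      (length_firstApp_le _).trans (length_step_le (G.seq m))
    rw [pow_succ]
    omega

/-- Distinct symbols stand for distinct binary strings of length 2^(depth - m). -/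
theorem width_le_two_pow_two_pow (hG : Function.Injective G.phi) (m : ℕ) :
    G.width m ≤ 2 ^ 2 ^ (G.depth - m) := by
  have h := G.balanced_seq m
  have hcard : ((firstApp (G.seq m)).toFinset.image symbolString).card = G.width m := by
    rw [Finset.card_image_of_injOn, List.toFinset_card_of_nodup (nodup_firstApp _), width]
    intro p hp r hr heq
    simp only [List.coe_toFinset, Set.mem_ofPred_eq, mem_firstApp] at hp hr
    exact h.symbolString_injOn hG hp hr heq
  rw [← hcard]
  refine card_le_two_pow fun y hy => ?_
  obtain ⟨p, hp, rfl⟩ := Finset.mem_image.1 hy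
  rw [List.mem_toFinset, mem_firstApp] at hp
  exact h.length_symbolString hp

/-! ### The entropy of the sequences -/

variable {s : ℕ} (P : FiniteStateSource s)

theorem maxProb_symbolString_pos_step {m : ℕ} {S : List (G.V × ℕ)} (hS : G.Balanced m S)
    (h : ∀ p ∈ S, 0 < P.maxProb (symbolString p)) :
    ∀ p ∈ G.step S, 0 < P.maxProb (symbolString p) := by
  intro p hp
  rcases mem_step.1 hp with hp | hp
  · obtain ⟨h₁, hp⟩ := mem_carried.1 hp
    have := h _ hp
    rw [symbolString_of_one_lt (by simp only; omega)] at this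
    exact (P.maxProb_pos_of_append this).1
  · obtain ⟨⟨v, q⟩, hr, hr₁, hp⟩ := mem_hat.1 hp
    have hq : q = 1 := by
      have := (hS _ hr).1
      simp only at this hr₁
      omega
    subst hq
    have := h _ hr
    match hs : G.succ v with
    | none => simp [expand, hs] at hp
    | some (a, b) =>
      rw [symbolString_of_succ hs] at this
      rw [expand_of_succ hs] at hp
      simp only [List.mem_cons, List.not_mem_nil, or_false] at hp
      rcases hp with rfl | rfl
      · exact (P.maxProb_pos_of_append this).1
      · exact (P.maxProb_pos_of_append this).2

/-- The strings of all symbols are substrings of x, so a possible x keeps every logarithm of a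
probability away from `Real.logb 2 0`. -/
theorem maxProb_symbolString_pos (hr : 0 < P.maxProb (G.phi G.root)) (m : ℕ) :
    ∀ p ∈ G.seq m, 0 < P.maxProb (symbolString p) := by
  induction m with
  | zero =>
    intro p hp
    rw [seq, List.mem_singleton] at hp
    subst hp
    simpa [symbolString, strPow_one] using hr
  | succ m ih => exact maxProb_symbolString_pos_step P (G.balanced_seq m) ih

/-- The cost serves as potential: both replacements cut the string of a symbol into its halves, and
the cost is superadditive. A carried-over symbol keeps only one of its two equal halves. -/
theorem Balanced.sum_cost_le {m : ℕ} {S : List (G.V × ℕ)} (hS : G.Balanced m S)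
    (h : ∀ p ∈ S, 0 < P.maxProb (symbolString p)) :
    ((firstApp (G.step S)).map fun p => P.cost (symbolString p)).sum +
      (((G.piOne S).map fun p => P.cost (symbolString p)).sum +
        ((strikeFirst [] (G.piTwo S)).map fun p => P.cost (symbolString p)).sum) ≤
      ((firstApp S).map fun p => P.cost (symbolString p)).sum := by
  refine hS.sum_potential_le _ (fun p hp h₁ => ?_) fun p hp h₁ => ?_
  · have hpos := h p hp
    rw [symbolString_of_one_lt h₁] at hpos ⊢
    have := P.cost_add_cost_le hpos
    have := P.cost_nonneg (symbolString (p.1, p.2 - 1))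
    linarith
  · obtain ⟨v, q⟩ := p
    have hq : q = 1 := by
      have := (hS _ hp).1
      simp only at this h₁
      omega
    subst hq
    have hpos := h _ hp
    match hs : G.succ v with
    | none => simpa [expand, hs] using P.cost_nonneg _
    | some (a, b) =>
      rw [symbolString_of_succ hs] at hpos ⊢
      simpa [expand_of_succ hs] using P.cost_add_cost_le hpos

/-- Gibbs' inequality with the weights `maxProb / s`, a subprobability because distinct symbols
stand for distinct strings of one length. -/
theorem Balanced.seqEntropy_le {m : ℕ} {S u : List (G.V × ℕ)} (hS : G.Balanced m S)
    (hG : Function.Injective G.phi) (h : ∀ p ∈ S, 0 < P.maxProb (symbolString p))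
    (hu : ∀ p ∈ u, p ∈ S) :
    seqEntropy u ≤
      (u.map fun p => P.cost (symbolString p)).sum + u.length * Real.logb 2 s := by
  have hs : (0 : ℝ) < s := by exact_mod_cast P.states_pos
  have hsum : ∑ p ∈ u.toFinset, P.maxProb (symbolString p) / s ≤ 1 := by
    rw [← Finset.sum_div, div_le_one hs]
    have hinj : Set.InjOn symbolString (u.toFinset : Set (G.V × ℕ)) := by
      intro p hp r hr heq
      simp only [List.coe_toFinset, Set.mem_ofPred_eq] at hp hr
      exact hS.symbolString_injOn hG (hu p hp) (hu r hr) heq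
    rw [← Finset.sum_image (f := P.maxProb) hinj]
    refine P.sum_maxProb_le (l := 2 ^ (G.depth - m)) fun y hy => ?_
    obtain ⟨p, hp, rfl⟩ := Finset.mem_image.1 hy
    exact hS.length_symbolString (hu p (List.mem_toFinset.1 hp))
  refine (seqEntropy_le_sum_neg_logb u _ (fun p hp => div_pos (h p (hu p hp)) hs) hsum).trans ?_
  have key : ∀ l : List (G.V × ℕ), (∀ p ∈ l, p ∈ S) →
      (l.map fun p => -Real.logb 2 (P.maxProb (symbolString p) / s)).sum =
        (l.map fun p => P.cost (symbolString p)).sum + l.length * Real.logb 2 s := by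
    intro l hl
    induction l with
    | nil => simp
    | cons p l ih =>
      have ih := ih fun r hr => hl r (List.mem_cons_of_mem _ hr)
      have hp := h p (hl p List.mem_cons_self)
      simp only [List.map_cons, List.sum_cons, ih, List.length_cons,
        Real.logb_div hp.ne' hs.ne', FiniteStateSource.cost]
      push_cast
      ring
  exact (key u hu).le

end LevelGraph

/-! ### The length of the codeword -/

namespace LevelGraph

variable {G : LevelGraph} {s : ℕ} (P : FiniteStateSource s)

/-- The sum of the powers of the distinct entries of `G.seq m`. -/
def powerSum (G : LevelGraph) (m : ℕ) : ℕ := ((firstApp (G.seq m)).map Prod.snd).sum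

/-- The sum of the ideal code lengths of the distinct entries of `G.seq m`. -/
noncomputable def costSum (G : LevelGraph) (m : ℕ) : ℝ :=
  ((firstApp (G.seq m)).map fun p => P.cost (symbolString p)).sum

/-- The 7 is 2 + 2 + 2 for S_i, Ŝ_i and π², plus 1 from the powers. The factor 2 of log₂ s bounds
the symbols in the two entropies, and the summand 2 covers the two ceilings. -/
theorem length_stepCode_le (hG : Function.Injective G.phi) (hr : 0 < P.maxProb (G.phi G.root))
    (m : ℕ) :
    ((G.stepCode (G.seq m)).length : ℝ) ≤ (7 + 2 * Real.logb 2 s) * G.width m + 2 +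
      ((G.powerSum (m + 1) : ℝ) - G.powerSum m) - (G.costSum P (m + 1) - G.costSum P m) := by
  have hS := G.balanced_seq m
  have hpos := maxProb_symbolString_pos P hr
  have h₁ : ((G.step (G.seq m)).length : ℝ) ≤ 2 * G.width m := by
    exact_mod_cast length_step_le (G.seq m)
  have h₂ : ((G.hat (G.seq m)).length : ℝ) ≤ 2 * G.width m := by
    exact_mod_cast length_hat_le (G.seq m)
  have h₃ : ((G.piTwo (G.seq m)).length : ℝ) ≤ 2 * G.width m := by
    exact_mod_cast length_piTwo_le (G.seq m)
  have h₄ : ((G.piOne (G.seq m)).length : ℝ) + (strikeFirst [] (G.piTwo (G.seq m))).length ≤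
      2 * G.width m := by
    exact_mod_cast hS.length_piOne_add_le
  have h₅ : (G.powerSum m : ℝ) + ((firstApp (G.piTwo (G.seq m))).map Prod.snd).sum =
      G.powerSum (m + 1) + G.width m := by
    exact_mod_cast hS.sum_powers_add
  have h₆ := hS.sum_cost_le P (hpos m)
  have hmem := fun p => (hS.step_perm.mem_iff (a := p)).2
  have h₇ := hS.step.seqEntropy_le P hG (hpos (m + 1)) (u := G.piOne (G.seq m)) fun p hp =>
    hmem p (by simp [hp])
  have h₈ := hS.step.seqEntropy_le P hG (hpos (m + 1))
    (u := strikeFirst [] (G.piTwo (G.seq m))) fun p hp => hmem p (by simp [hp])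
  have h₉ := (Nat.ceil_lt_add_one (seqEntropy_nonneg (G.piOne (G.seq m)))).le
  have h₁₀ := (Nat.ceil_lt_add_one (seqEntropy_nonneg (strikeFirst [] (G.piTwo (G.seq m))))).le
  have hs : 0 ≤ Real.logb 2 (s : ℝ) :=
    div_nonneg (Real.log_natCast_nonneg s) (Real.log_nonneg one_le_two)
  have h₁₁ := mul_le_mul_of_nonneg_right h₄ hs
  have e₁ : G.costSum P m = ((firstApp (G.seq m)).map fun p => P.cost (symbolString p)).sum := rfl
  have e₂ : G.costSum P (m + 1) =
    ((firstApp (G.step (G.seq m))).map fun p => P.cost (symbolString p)).sum := rfl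
  rw [length_stepCode]
  push_cast
  push_cast at h₅
  linarith

/-- In the last sequence L(v) = depth + q, while no level exceeds depth + 1, so every power is 1. -/
theorem powerSum_depth_le (G : LevelGraph) : G.powerSum G.depth ≤ G.width G.depth := by
  rw [powerSum, width, ← List.length_map (as := firstApp (G.seq G.depth)) Prod.snd]
  refine (List.sum_le_card_nsmul _ 1 fun q hq => ?_).trans (by simp)
  obtain ⟨p, hp, rfl⟩ := List.mem_map.1 hq
  have := G.balanced_seq G.depth p (mem_firstApp.1 hp)
  have := G.level_le p.1
  omega

theorem length_codeword_add_logb_prob_le {x : List Bool} (hG : G.IsROBDDOf x)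
    (hx : P.prob x ≠ 0) :
    (G.codeword.length : ℝ) + Real.logb 2 (P.prob x) ≤
      (7 + 2 * Real.logb 2 s) * ∑ m ∈ Finset.range (G.depth + 1), (G.width m : ℝ) +
        2 * G.depth + 1 := by
  have hprob : 0 < P.prob x := (P.prob_nonneg x).lt_of_ne' hx
  have hmax : 0 < P.maxProb (G.phi G.root) := by
    rw [hG.2]
    exact hprob.trans_le (P.prob_le_maxProb x)
  have hlen : (G.codeword.length : ℝ) =
      ∑ m ∈ Finset.range G.depth, ((G.stepCode (G.seq m)).length : ℝ) + 1 := by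
    rw [codeword, List.length_append, List.length_flatMap, List.length_singleton,
      ← List.sum_toFinset _ List.nodup_range, List.toFinset_range]
    push_cast
    rfl
  have hsum := Finset.sum_le_sum fun m (_ : m ∈ Finset.range G.depth) =>
    length_stepCode_le P hG.1 hmax m
  rw [Finset.sum_sub_distrib, Finset.sum_add_distrib, Finset.sum_add_distrib,
    Finset.sum_range_sub (fun m => (G.powerSum m : ℝ)), Finset.sum_range_sub (G.costSum P),
    ← Finset.mul_sum, Finset.sum_const, Finset.card_range, nsmul_eq_mul] at hsum
  have hpow : (G.powerSum G.depth : ℝ) ≤ G.width G.depth := by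
    exact_mod_cast G.powerSum_depth_le
  have hpow₀ : (0 : ℝ) ≤ G.powerSum 0 := Nat.cast_nonneg _
  have hcost₀ : G.costSum P 0 = P.cost x := by
    simp [costSum, seq, firstApp, symbolString, strPow_one, hG.2]
  have hcost : 0 ≤ G.costSum P G.depth := by
    refine List.sum_nonneg fun r hr => ?_
    obtain ⟨p, -, rfl⟩ := List.mem_map.1 hr
    exact P.cost_nonneg _
  have hx' : P.cost x ≤ -Real.logb 2 (P.prob x) :=
    neg_le_neg (Real.logb_le_logb_of_le one_lt_two hprob (P.prob_le_maxProb x))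
  have hs : 0 ≤ Real.logb 2 (s : ℝ) :=
    div_nonneg (Real.log_natCast_nonneg s) (Real.log_nonneg one_le_two)
  have hw : 0 ≤ Real.logb 2 (s : ℝ) * G.width G.depth := mul_nonneg hs (Nat.cast_nonneg _)
  have hw' : (0 : ℝ) ≤ G.width G.depth := Nat.cast_nonneg _
  -- The steps only use m < depth; the additional summand m = depth absorbs the final power sum left
  -- by the telescoping.
  rw [Finset.sum_range_succ, hlen]
  linarith

end LevelGraph

/-! ### The number of nodes of a diagram -/

/-- A bound for the total number of distinct dyadic substrings of a string of length `2 ^ k`. -/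
def dyadicCount (k : ℕ) : ℕ := ∑ m ∈ Finset.range (k + 1), min (2 ^ m) (2 ^ 2 ^ (k - m))

theorem LevelGraph.sum_width_le {G : LevelGraph} (hG : Function.Injective G.phi) :
    ∑ m ∈ Finset.range (G.depth + 1), (G.width m : ℝ) ≤ dyadicCount G.depth := by
  rw [dyadicCount, Nat.cast_sum]
  refine Finset.sum_le_sum fun m _ => ?_
  exact_mod_cast le_min (G.width_le_two_pow m) (G.width_le_two_pow_two_pow hG m)

/-- The selected m satisfy m ≤ k - ⌈log₂ t⌉, and a geometric sum is less than twice its last term.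
-/
theorem mul_sum_filter_two_pow_le (k t : ℕ) :
    t * ∑ m ∈ (Finset.range (k + 1)).filter (fun m => t ≤ 2 ^ (k - m)), 2 ^ m ≤ 2 ^ (k + 1) := by
  rcases lt_or_ge k (Nat.clog 2 t) with hk | hk
  · rw [Finset.filter_false_of_mem]
    · simp
    · intro m _ ht
      have := Nat.clog_le_of_le_pow ht
      omega
  · have hsub : (Finset.range (k + 1)).filter (fun m => t ≤ 2 ^ (k - m)) ⊆
        Finset.range (k - Nat.clog 2 t + 1) := by
      intro m hm
      rw [Finset.mem_filter, Finset.mem_range] at hm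
      have := Nat.clog_le_of_le_pow hm.2
      rw [Finset.mem_range]
      omega
    calc t * ∑ m ∈ (Finset.range (k + 1)).filter (fun m => t ≤ 2 ^ (k - m)), 2 ^ m
        ≤ 2 ^ Nat.clog 2 t * 2 ^ (k - Nat.clog 2 t + 1) :=
          Nat.mul_le_mul (Nat.le_pow_clog one_lt_two t) ((Finset.sum_le_sum_of_subset hsub).trans
            (Nat.geomSum_lt le_rfl fun m hm => Finset.mem_range.1 hm).le)
      _ = 2 ^ (k + 1) := by
          rw [← pow_add]
          congr 1
          omega

/-- The bound 2^m is used while the strings have length at least t; for shorter ones there are at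
most 2^t strings at each of at most k + 1 levels. -/
theorem mul_dyadicCount_le (k t : ℕ) :
    t * dyadicCount k ≤ 2 ^ (k + 1) + t * ((k + 1) * 2 ^ t) := by
  have hterm : ∀ m ∈ Finset.range (k + 1), min (2 ^ m) (2 ^ 2 ^ (k - m)) ≤
      (if t ≤ 2 ^ (k - m) then 2 ^ m else 0) + 2 ^ t := by
    intro m _
    split_ifs with h
    · exact (min_le_left _ _).trans (Nat.le_add_right _ _)
    · rw [zero_add]
      exact (min_le_right _ _).trans (Nat.pow_le_pow_right two_pos (not_le.1 h).le)
  refine (Nat.mul_le_mul_left t (Finset.sum_le_sum hterm)).trans ?_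
  rw [Finset.sum_add_distrib, ← Finset.sum_filter, Finset.sum_const, Finset.card_range,
    smul_eq_mul, mul_add]
  exact Nat.add_le_add_right (mul_sum_filter_two_pow_le k t) _

/-! ### Asymptotics of the redundancy bound -/

theorem tendsto_natLog_div_atTop :
    Tendsto (fun k : ℕ => (3 * ((Nat.log 2 k : ℝ) + 1)) / k) atTop (𝓝 0) := by
  have h₁ : Tendsto (fun k : ℕ => Real.log k / k) atTop (𝓝 0) :=
    (Real.isLittleO_log_id_atTop.tendsto_div_nhds_zero).comp tendsto_natCast_atTop_atTop
  have h₂ : Tendsto (fun k : ℕ => 3 / Real.log 2 * (Real.log k / k) + 3 / (k : ℝ)) atTop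
      (𝓝 (3 / Real.log 2 * 0 + 0)) :=
    (h₁.const_mul _).add (tendsto_const_div_atTop_nhds_zero_nat 3)
  rw [mul_zero, add_zero] at h₂
  refine squeeze_zero (fun k => by positivity) (fun k => ?_) h₂
  have h := Real.natLog_le_logb k 2
  rw [Real.logb, Nat.cast_ofNat] at h
  calc 3 * ((Nat.log 2 k : ℝ) + 1) / k ≤ 3 * (Real.log k / Real.log 2 + 1) / k := by gcongr
    _ = _ := by ring

/-- The bound `k / 2 ^ k` times `dyadicCount k` is eventually less than any number above `2`. -/
theorem eventually_dyadicCount_le {r : ℝ} (hr : 2 < r) :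
    ∀ᶠ k : ℕ in atTop, (k : ℝ) / 2 ^ k * dyadicCount k ≤ r := by
  have hlim : Tendsto (fun k : ℕ => 2 / (1 - (3 * ((Nat.log 2 k : ℝ) + 1)) / k) + 2 / (k : ℝ))
      atTop (𝓝 (2 / (1 - 0) + 0)) :=
    (tendsto_const_nhds.div (tendsto_const_nhds.sub tendsto_natLog_div_atTop) (by norm_num)).add
      (tendsto_const_div_atTop_nhds_zero_nat 2)
  norm_num at hlim
  filter_upwards [hlim.eventually_lt_const hr, tendsto_natLog_div_atTop.eventually_lt_const one_pos,
    eventually_ge_atTop 1] with k hk hlog h₁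
  refine le_trans ?_ hk.le
  have hk₀ : (0 : ℝ) < k := by exact_mod_cast h₁
  -- The threshold is t = k - e. This e gives 2^e ≥ k³, which makes the short strings negligible,
  -- and e = o(k), so the main term 2k/t still tends to 2.
  obtain ⟨e, he⟩ : ∃ e, e = 3 * (Nat.log 2 k + 1) := ⟨_, rfl⟩
  have hek : e < k := by
    rw [div_lt_one hk₀] at hlog
    rw [he]
    exact_mod_cast hlog
  obtain ⟨t, rfl⟩ : ∃ t, k = t + e := ⟨k - e, by omega⟩
  have ht : (0 : ℝ) < t := by
    have : 0 < t := by omega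
    exact_mod_cast this
  have hN : (t : ℝ) * dyadicCount (t + e) ≤
      2 ^ (t + e + 1) + t * (((t + e : ℕ) + 1) * 2 ^ t) := by
    exact_mod_cast mul_dyadicCount_le (t + e) t
  have he₃ : ((t + e : ℕ) : ℝ) ^ 3 ≤ 2 ^ e := by
    have := (Nat.lt_pow_succ_log_self one_lt_two (t + e)).le
    have := Nat.pow_le_pow_left this 3
    rw [← pow_mul, mul_comm (Nat.log 2 (t + e)).succ 3, Nat.succ_eq_add_one, ← he] at this
    exact_mod_cast this
  have heq : 1 - 3 * ((Nat.log 2 (t + e) : ℝ) + 1) / ((t + e : ℕ) : ℝ) = t / ((t + e : ℕ) : ℝ) := by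
    have : (3 * ((Nat.log 2 (t + e) : ℝ) + 1)) = (e : ℝ) := by
      exact_mod_cast he.symm
    rw [this, eq_div_iff hk₀.ne', sub_mul, div_mul_cancel₀ _ hk₀.ne']
    push_cast
    ring
  rw [heq]
  set K : ℝ := ((t + e : ℕ) : ℝ) with hK
  have hK₁ : 1 ≤ K := by
    rw [hK]
    exact_mod_cast h₁
  have hN' : (dyadicCount (t + e) : ℝ) ≤ 2 ^ (t + e + 1) / t + (K + 1) * 2 ^ t := by
    rw [← mul_le_mul_iff_right₀ ht]
    refine hN.trans (le_of_eq ?_)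
    field_simp
  calc K / 2 ^ (t + e) * dyadicCount (t + e)
      ≤ K / 2 ^ (t + e) * (2 ^ (t + e + 1) / t + (K + 1) * 2 ^ t) := by gcongr
    _ = 2 / (t / K) + K * (K + 1) / 2 ^ e := by
        rw [pow_succ, pow_add]
        field_simp
    _ ≤ 2 / (t / K) + K * (K + 1) / K ^ 3 := by gcongr
    _ ≤ 2 / (t / K) + 2 / K := by
        refine add_le_add le_rfl ?_
        rw [div_le_div_iff₀ (by positivity) (by positivity)]
        nlinarith [mul_pos hk₀ hk₀]

theorem tendsto_mul_two_mul_add_one_div_two_pow :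
    Tendsto (fun k : ℕ => (k : ℝ) / 2 ^ k * (2 * k + 1)) atTop (𝓝 0) := by
  have h₁ := tendsto_pow_const_div_const_pow_of_one_lt 2 (one_lt_two (α := ℝ))
  have h₂ := tendsto_pow_const_div_const_pow_of_one_lt 1 (one_lt_two (α := ℝ))
  have := (h₁.const_mul 2).add h₂
  simp only [mul_zero, add_zero] at this
  refine this.congr fun k => ?_
  ring

/-- The bound for the redundancy, as a multiple of `n / log₂ n`, for strings of length
`n = 2 ^ k`. -/
noncomputable def redundancyBound (c : ℝ) (k : ℕ) : ℝ :=
  (k : ℝ) / 2 ^ k * ((7 + 2 * c) * dyadicCount k + 2 * k + 1)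

theorem eventually_redundancyBound_le {c : ℝ} (hc : 0 ≤ c) :
    ∀ᶠ k : ℕ in atTop, redundancyBound c k ≤ 16 + 4 * c := by
  -- With this r, (7 + 2c) r = 14 + 4c + 1; the remaining unit below 16 + 4c is left for the
  -- rounding terms.
  have hr : (2 : ℝ) < 2 + 1 / (7 + 2 * c) := by
    have : 0 < 1 / (7 + 2 * c) := by positivity
    linarith
  filter_upwards [eventually_dyadicCount_le hr,
    tendsto_mul_two_mul_add_one_div_two_pow.eventually_lt_const one_pos] with k h₁ h₂
  have h := mul_le_mul_of_nonneg_left h₁ (show 0 ≤ 7 + 2 * c by positivity)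
  rw [mul_add, mul_one_div_cancel (by positivity)] at h
  have e : redundancyBound c k = (7 + 2 * c) * ((k : ℝ) / 2 ^ k * dyadicCount k) +
      (k : ℝ) / 2 ^ k * (2 * k + 1) := by
    rw [redundancyBound]
    ring
  rw [e]
  linarith

/-- The error term `ε_n` in the redundancy bound. -/
noncomputable def redundancyError (c : ℝ) (n : ℕ) : ℝ :=
  max 0 (redundancyBound c (Nat.log 2 n) - (16 + 4 * c))

theorem tendsto_redundancyError {c : ℝ} (hc : 0 ≤ c) :
    Tendsto (redundancyError c) atTop (𝓝 0) := by
  have hlog : Tendsto (Nat.log 2) atTop atTop :=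
    tendsto_atTop_mono' _ (Eventually.of_forall fun _ => le_rfl)
      (tendsto_atTop_atTop.2 fun b => ⟨2 ^ b, fun n hn =>
        Nat.le_log_of_pow_le one_lt_two hn⟩)
  -- The bound eventually drops below 16 + 4c, so the error term is eventually equal to 0.
  refine tendsto_const_nhds.congr' ?_
  filter_upwards [hlog.eventually (eventually_redundancyBound_le hc)] with n hn
  rw [redundancyError, max_eq_left (by linarith)]

/-! ### Conclusion -/

theorem theorem1 :
    (∀ x ∈ SDyadic, ∃ G : LevelGraph, G.IsROBDDOf x ∧
      ∀ G' : LevelGraph, G'.IsROBDDOf x → G.Isomorphic G') ∧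
    ∀ s : ℕ, ∃ ε : ℕ → ℝ, Tendsto ε atTop (𝓝 0) ∧
      ∀ P : FiniteStateSource s, ∀ k : ℕ, 1 ≤ k → ∀ n : ℕ, n = 2 ^ k →
        ∀ x ∈ SDyadic, x.length = n → P.prob x ≠ 0 →
          ∀ G : LevelGraph, G.IsROBDDOf x →
            (G.codeword.length : ℝ) + Real.logb 2 (P.prob x) ≤
                (n : ℝ) / Real.logb 2 (n : ℝ) * (16 + 4 * Real.logb 2 (s : ℝ) + ε n) ∧
            ((G.codeword.length : ℝ) + Real.logb 2 (P.prob x)) / (n : ℝ) ≤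
                (4 * Real.logb 2 (s : ℝ) + 16 + ε n) / Real.logb 2 (n : ℝ) := by
  refine ⟨fun x hx => ?_, fun s => ?_⟩
  · obtain ⟨G, hG⟩ := exists_isROBDDOf hx
    exact ⟨G, hG, fun G' hG' => hG.isomorphic hG'⟩
  have hs : 0 ≤ Real.logb 2 (s : ℝ) :=
    div_nonneg (Real.log_natCast_nonneg s) (Real.log_nonneg one_le_two)
  refine ⟨redundancyError (Real.logb 2 s), tendsto_redundancyError hs, ?_⟩
  rintro P k hk n rfl x - hlen hprob G hG
  obtain rfl : G.depth = k := hG.depth_eq hlen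
  have hk₀ : (0 : ℝ) < G.depth := by exact_mod_cast hk
  have hlog : Real.logb 2 ((2 ^ G.depth : ℕ) : ℝ) = G.depth := by
    rw [Nat.cast_pow, Nat.cast_ofNat, Real.logb_pow, Real.logb_self_eq_one one_lt_two, mul_one]
  have hn : (0 : ℝ) < ((2 ^ G.depth : ℕ) : ℝ) := by positivity
  have hbound : redundancyBound (Real.logb 2 s) G.depth ≤
      16 + 4 * Real.logb 2 s + redundancyError (Real.logb 2 s) (2 ^ G.depth) := by
    rw [redundancyError, Nat.log_pow one_lt_two]
    linarith [le_max_right 0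
      (redundancyBound (Real.logb 2 s) G.depth - (16 + 4 * Real.logb 2 s))]
  have hmain : (G.codeword.length : ℝ) + Real.logb 2 (P.prob x) ≤
      ((2 ^ G.depth : ℕ) : ℝ) / G.depth *
        (16 + 4 * Real.logb 2 s + redundancyError (Real.logb 2 s) (2 ^ G.depth)) := by
    refine le_trans ?_ (mul_le_mul_of_nonneg_left hbound (by positivity))
    have hwidth := mul_le_mul_of_nonneg_left (LevelGraph.sum_width_le hG.1)
      (show 0 ≤ 7 + 2 * Real.logb 2 (s : ℝ) by positivity)
    have e : ((2 ^ G.depth : ℕ) : ℝ) / G.depth * redundancyBound (Real.logb 2 s) G.depth =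
        (7 + 2 * Real.logb 2 s) * dyadicCount G.depth + 2 * G.depth + 1 := by
      rw [redundancyBound, Nat.cast_pow, Nat.cast_ofNat]
      field_simp
    rw [e]
    exact (LevelGraph.length_codeword_add_logb_prob_le P hG hprob).trans (by linarith)
  rw [hlog]
  refine ⟨hmain, ?_⟩
  rw [div_le_iff₀ hn]
  refine hmain.trans (le_of_eq ?_)
  ring
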